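/- Let $L>0$ and $\Omega=(0,L)$. There is a constant $C$, depending only on $\Omega$, such that the following holds. Let $0<\alpha_1\le\alpha_2$, let $A^\varepsilon\in W^{1,\infty}(\Omega)$ satisfy $\alpha_1\le A^\varepsilon\le\alpha_2$ a.e. on $\Omega$, let $b\neq0$ be a real constant and $f\in L^2(\Omega)$. Let $u^\varepsilon\in H^1_0(\Omega)$ be the solution of $-(A^\varepsilon (u^\varepsilon)')'+b(u^\varepsilon)'=f$ in $\Omega$, $u^\varepsilon(0)=u^\varepsilon(L)=0$, that is, $a^\varepsilon(u^\varepsilon,v)=F(v)$ for all $v\in H^1_0(\Omega)$, where $$a^\varepsilon(u,v)=\int_\Omega A^\varepsilon u'v'+b\,u'v,\qquad F(v)=\int_\Omega fv .$$ Let $\mathcal T_H$ be a (coarse) mesh of $[0,L]$ of size $H$, and let $\mathcal T_h$ be a (fine) mesh of size $h$ that refines $\mathcal T_H$ (the size of a mesh is the length of its longest element). Let $V_h\subset H^1_0(\Omega)$ be the $\mathbb P^1$ finite element space of $\mathcal T_h$. For each interior node $x_i$ of $\mathcal T_H$ let $\psi_i^{\varepsilon,h}\in V_h$ be the approximate multiscale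 basis function: it equals $1$ at $x_i$ and $0$ at the other nodes of $\mathcal T_H$, and on every $\mathbf K\in\mathcal T_H$ one has $\int_{\mathbf K}A^\varepsilon(\psi_i^{\varepsilon,h})'v'=0$ for all $v\in V_h$ vanishing on $\partial\mathbf K$. Let $V^\varepsilon_{H,h}$ be the span of these functions, let $\tau_{\mathbf K}=\frac{H}{2|b|}$ for all $\mathbf K\in\mathcal T_H$, and let $u^\varepsilon_{H,h}\in V^\varepsilon_{H,h}$ be the Stab-MsFEM approximation, that is, for all $v\in V^\varepsilon_{H,h}$, $$a^\varepsilon(u^\varepsilon_{H,h},v)+\sum_{\mathbf K\in\mathcal T_H}\int_{\mathbf K}\tau_{\mathbf K}\,b(u^\varepsilon_{H,h})'\,b v'=F(v)+\sum_{\mathbf K\in\mathcal T_H}\int_{\mathbf K}\tau_{\mathbf K}f\,b v'.$$ Assume that $\frac{|b|L}{\alpha_2}\ge1$ and $\frac{|b|H}{2\alpha_1}\ge1$. Then, with $|v|_{H^1(\Omega)}=\|v'\|_{L^2(\Omega)}$, $$|u^\varepsilon-u^\varepsilon_{H,h}|_{H^1(\Omega)}\le C\left(1+\frac{H|b|}{\alpha_1}+\frac{H|b|}{\alpha_1}\sqrt{\frac{\alpha_2^2}{\alpha_1^2}+\frac{|b|H}{\alpha_1}}\right)e_h+CH\left(1+\sqrt{\frac{\alpha_2^2}{\alpha_1^2}+\frac{|b|H}{\alpha_1}}\right)\left(1+\frac{\sqrt{2\alpha_2L|b|}}{\alpha_1}\right)\frac{\|f\|_{L^2(\Omega)}}{\alpha_1},$$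 where $$e_h=h\left(\sqrt{\frac{\alpha_2}{\alpha_1}}+\frac{|b|h}{\alpha_1}\right)\left(1+\sqrt{\frac{2\alpha_2L}{|b|}}\,\frac{\|(A^\varepsilon)'-b\|_{L^\infty(\Omega)}}{\alpha_1}\right)\frac{\|f\|_{L^2(\Omega)}}{\alpha_1}.$$ -/

import Mathlib

open MeasureTheory Set
open scoped ContDiff

namespace StabMsFEM

noncomputable section

/-! ### Sobolev spaces on the interval `(0, L)` -/

/-- Lebesgue measure on the interval `(0, L)`. -/
abbrev vol (L : ℝ) : Measure ℝ := volume.restrict (Ioo 0 L)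

/-- The norm of `L^p(0, L)` as a real number (used for functions in `L^p(0, L)` only). -/
def normLp (L : ℝ) (p : ENNReal) (g : ℝ → ℝ) : ℝ := (eLpNorm g p (vol L)).toReal

/-- `g` is a weak derivative of `u` on `(0, L)`: both are locally integrable there and
`∫ u φ' = - ∫ g φ` for every smooth `φ` with compact support in `(0, L)`. -/
def IsWeakDeriv (L : ℝ) (u g : ℝ → ℝ) : Prop :=
  LocallyIntegrableOn u (Ioo 0 L) ∧ LocallyIntegrableOn g (Ioo 0 L) ∧
    ∀ φ : ℝ → ℝ, ContDiff ℝ ∞ φ → HasCompactSupport φ → tsupport φ ⊆ Ioo 0 L →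
      ∫ x in Ioo 0 L, u x * deriv φ x = - ∫ x in Ioo 0 L, g x * φ x

open Classical in
/-- The weak derivative of `u` on `(0, L)` (some representative; it is unique almost everywhere).
It is `0` when there is none. -/
def weakDeriv (L : ℝ) (u : ℝ → ℝ) : ℝ → ℝ :=
  if h : ∃ g, IsWeakDeriv L u g then h.choose else 0

/-- `u ∈ W^{1,p}(0, L)`. -/
def MemW1 (L : ℝ) (p : ENNReal) (u : ℝ → ℝ) : Prop :=
  MemLp u p (vol L) ∧ ∃ g, IsWeakDeriv L u g ∧ MemLp g p (vol L)

/-- `u ∈ H¹₀(0, L)`: functions of `H¹(0, L) = W^{1,2}(0, L)`, taken as their representative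
continuous on `[0, L]`, that vanish at `0` and at `L`. Values outside `[0, L]` play no role. -/
def MemH10 (L : ℝ) (u : ℝ → ℝ) : Prop :=
  MemW1 L 2 u ∧ ContinuousOn u (Icc 0 L) ∧ u 0 = 0 ∧ u L = 0

/-- The seminorm `|u|_{H¹(0, L)} = ‖u'‖_{L²(0, L)}`. -/
def seminormH1 (L : ℝ) (u : ℝ → ℝ) : ℝ := normLp L 2 (weakDeriv L u)

/-! ### The continuous problem -/

/-- The bilinear form `∫ A u' v' + b u' v` on `(0, L)`. -/
def aForm (L : ℝ) (A : ℝ → ℝ) (b : ℝ) (u v : ℝ → ℝ) : ℝ :=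
  ∫ x in Ioo 0 L, A x * weakDeriv L u x * weakDeriv L v x + b * weakDeriv L u x * v x

/-- The linear form `∫ f v` on `(0, L)`. -/
def loadForm (L : ℝ) (f v : ℝ → ℝ) : ℝ := ∫ x in Ioo 0 L, f x * v x

/-- `u` is the weak solution of `-(A u')' + b u' = f` in `(0, L)`, `u(0) = u(L) = 0`. -/
def IsSolution (L : ℝ) (A : ℝ → ℝ) (b : ℝ) (f u : ℝ → ℝ) : Prop :=
  MemH10 L u ∧ ∀ v, MemH10 L v → aForm L A b u v = loadForm L f v

/-! ### Meshes and finite element spaces -/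

/-- A mesh of `[0, L]`: nodes `0 = x_0 < x_1 < ⋯ < x_n = L`, with the `n` elements
`[x_k, x_{k+1}]`. -/
structure Mesh (L : ℝ) where
  n : ℕ
  node : Fin (n + 1) → ℝ
  strictMono : StrictMono node
  node_zero : node 0 = 0
  node_last : node (Fin.last n) = L

/-- The left end point of the element `k`. -/
def Mesh.left {L : ℝ} (T : Mesh L) (k : Fin T.n) : ℝ := T.node k.castSucc

/-- The right end point of the element `k`. -/
def Mesh.right {L : ℝ} (T : Mesh L) (k : Fin T.n) : ℝ := T.node k.succ

/-- The mesh size: the length of the longest element. -/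
def Mesh.size {L : ℝ} (T : Mesh L) : ℝ := ⨆ k : Fin T.n, (T.right k - T.left k)

/-- `Th` is a refinement of `TH`: every node of `TH` is a node of `Th`, so that `Th` restricts to a
mesh of each element of `TH`. -/
def Mesh.Refines {L : ℝ} (Th TH : Mesh L) : Prop := range TH.node ⊆ range Th.node

/-- `v` belongs to the `P¹` finite element space of the mesh `T` with zero boundary values:
`v ∈ H¹₀(0, L)` is affine on each element. -/
def MemP1 {L : ℝ} (T : Mesh L) (v : ℝ → ℝ) : Prop :=
  MemH10 L v ∧ ∀ k : Fin T.n, ∃ p q : ℝ, ∀ x ∈ Icc (T.left k) (T.right k), v x = p * x + q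

/-- `ψ` is the approximate multiscale basis function attached to the node `i` of the coarse mesh
`TH`. On each coarse element `K`, `ψ` is the `P¹` approximation on the fine mesh of the local problem
`-(A ψ')' = 0` in `K`, `ψ = φ` on `∂K`, where `φ` is the coarse `P¹` hat function of the node `i`
(equal to `1` at this node and to `0` at all others). The test functions on `K` are the restrictions
to `K` of fine-scale `P¹` functions that vanish on `∂K`. -/
def IsMsBasis {L : ℝ} (A : ℝ → ℝ) (TH Th : Mesh L) (i : Fin (TH.n + 1)) (ψ : ℝ → ℝ) : Prop :=
  MemP1 Th ψ ∧
  (∀ j, ψ (TH.node j) = if j = i then 1 else 0) ∧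
  ∀ k : Fin TH.n, ∀ v : ℝ → ℝ, MemP1 Th v → v (TH.left k) = 0 → v (TH.right k) = 0 →
    ∫ x in Ioo (TH.left k) (TH.right k), A x * weakDeriv L ψ x * weakDeriv L v x = 0

/-- The multiscale space `V_{H,h}`: the span of the approximate multiscale basis functions of the
interior nodes of the coarse mesh. -/
def msSpace {L : ℝ} (A : ℝ → ℝ) (TH Th : Mesh L) : Submodule ℝ (ℝ → ℝ) :=
  Submodule.span ℝ {ψ | ∃ i : Fin (TH.n + 1), i ≠ 0 ∧ i ≠ Fin.last TH.n ∧ IsMsBasis A TH Th i ψ}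

/-! ### The Stab-MsFEM method -/

/-- The stabilization term `∑_K (τ_K b u', b v')_K`. -/
def aUpw {L : ℝ} (TH : Mesh L) (τ : Fin TH.n → ℝ) (b : ℝ) (u v : ℝ → ℝ) : ℝ :=
  ∑ k, ∫ x in Ioo (TH.left k) (TH.right k), τ k * (b * weakDeriv L u x) * (b * weakDeriv L v x)

/-- The stabilization term `∑_K (τ_K f, b v')_K`. -/
def fStab {L : ℝ} (TH : Mesh L) (τ : Fin TH.n → ℝ) (b : ℝ) (f v : ℝ → ℝ) : ℝ :=
  ∑ k, ∫ x in Ioo (TH.left k) (TH.right k), τ k * f x * (b * weakDeriv L v x)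

/-- `w` is the Stab-MsFEM approximation, with stabilization parameters `τ`: `w ∈ V_{H,h}` and
`a(w, v) + a_upw(w, v) = F(v) + F_stab(v)` for all `v ∈ V_{H,h}`. -/
def IsStabMsFEM {L : ℝ} (A : ℝ → ℝ) (b : ℝ) (f : ℝ → ℝ) (TH Th : Mesh L) (τ : Fin TH.n → ℝ)
    (w : ℝ → ℝ) : Prop :=
  w ∈ msSpace A TH Th ∧ ∀ v ∈ msSpace A TH Th,
    aForm L A b w v + aUpw TH τ b w v = loadForm L f v + fStab TH τ b f v

/-- The fine-scale error term `e_h`. -/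
def fineError (L α₁ α₂ b h : ℝ) (A f : ℝ → ℝ) : ℝ :=
  h * (√(α₂ / α₁) + |b| * h / α₁) *
    (1 + √(2 * α₂ * L / |b|) * (normLp L ⊤ (fun x => weakDeriv L A x - b) / α₁)) *
    (normLp L 2 f / α₁)

end

end StabMsFEM

open StabMsFEM

open StabMsFEM

/-! The error is split at the multiscale interpolant `z`, the element of the multiscale space equal
to `u` at the coarse nodes. Throughout, `G = ‖f - b u'‖`, which is the norm of `(A u')'`, and norms
are in `L²`.

Interpolation error. Let `v` be the fine `P¹` interpolant of `u`. Then `v - z` is a fine `P¹`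
function vanishing at the coarse nodes, so `A z'` is orthogonal to `(v - z)'`, whereas pairing `A
u'` with `(v - z)'` gives `∫ (f - b u') (v - z)`, at most `G H |v - z|_{H¹}` by Poincaré on each
coarse element. Comparing energies yields `|u - z| ≤ √(α₂/α₁) |u - v| + 2 H G / α₁`
(`IsSolution.normLp_sub_msInterpolant_le`).

Discrete error. The error equation is tested with `e = w - z`. As `d = u - z` vanishes at the coarse
nodes, the transport term is `-b ∫ d e'` with `‖d‖ ≤ H |d|`; the stabilization `τ b² |e|²`, where `2
τ b² = H |b|`, absorbs it with no Péclet number left over. The stabilization omits the diffusive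
part of the residual, which costs `H G / 2`. Hence `|w - z| ≤ (α₂/α₁ + 3) |u - z| + H G / (2 α₁)`
(`IsStabMsFEM.normLp_sub_le`).

Data bounds. Testing the equation with `u`, and with `u` times an affine weight decreasing in the
flow direction, bounds `|u|_{H¹}` by `√(2 α₂ L / |b|) ‖f‖ / α₁` up to a factor 3
(`IsSolution.normLp_weakDeriv_le`). This controls `G`, and also `u'' = -(f + (A' - b) u') / A`,
hence `|u - v|` (`IsSolution.exists_fine_interpolant`).

In one dimension every weak derivative in `L¹` has an absolutely continuous primitive, so
integrations by parts and nodal values are handled through `IsAntideriv`. -/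

namespace StabMsFEM

/-! ### Antiderivatives of integrable functions -/

/-- On `[0, L]`, the function `u` is an antiderivative of the integrable function `g`. -/
structure IsAntideriv (L : ℝ) (u g : ℝ → ℝ) : Prop where
  integrable : IntegrableOn g (Ioo 0 L)
  eq_add_integral : ∀ x ∈ Icc 0 L, u x = u 0 + ∫ t in 0..x, g t

/-- Serves twice: with `K = 1` to replace a function by one equal to it on the interval, and with `K
= α⁻²` for reciprocals. -/
theorem absolutelyContinuousOnInterval_of_dist_le {f g : ℝ → ℝ} {a b K : ℝ}
    (hf : AbsolutelyContinuousOnInterval f a b) (hK : 0 < K)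
    (h : ∀ x ∈ uIcc a b, ∀ y ∈ uIcc a b, dist (g x) (g y) ≤ K * dist (f x) (f y)) :
    AbsolutelyContinuousOnInterval g a b := by
  rw [absolutelyContinuousOnInterval_iff] at hf ⊢
  intro ε hε
  obtain ⟨δ, hδ, H⟩ := hf (ε / K) (div_pos hε hK)
  refine ⟨δ, hδ, fun E hE hE' => ?_⟩
  refine (Finset.sum_le_sum fun i hi => h _ (hE.1 i hi).1 _ (hE.1 i hi).2).trans_lt ?_
  rw [← Finset.mul_sum, mul_comm, ← lt_div_iff₀ hK]
  exact H E hE hE'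

theorem setIntegral_Ioo_eq_intervalIntegral {a b : ℝ} (hab : a ≤ b) (F : ℝ → ℝ) :
    ∫ x in Ioo a b, F x = ∫ x in a..b, F x := by
  rw [intervalIntegral.integral_of_le hab, integral_Ioc_eq_integral_Ioo]

theorem intervalIntegrable_of_integrableOn_Ioo {L a b : ℝ} {g : ℝ → ℝ}
    (hg : IntegrableOn g (Ioo 0 L)) (ha : a ∈ Icc 0 L) (hb : b ∈ Icc 0 L) :
    IntervalIntegrable g volume a b := by
  have hL : (0 : ℝ) ≤ L := ha.1.trans ha.2
  have h : IntervalIntegrable g volume 0 L := by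
    rw [intervalIntegrable_iff_integrableOn_Ioo_of_le hL]; exact hg
  refine h.mono_set ?_
  rw [uIcc_of_le hL]
  exact (convex_Icc 0 L).ordConnected.uIcc_subset ha hb

namespace IsAntideriv

variable {L : ℝ} {u v g k : ℝ → ℝ}

theorem intervalIntegrable (h : IsAntideriv L u g) {a b : ℝ} (ha : a ∈ Icc 0 L)
    (hb : b ∈ Icc 0 L) : IntervalIntegrable g volume a b :=
  intervalIntegrable_of_integrableOn_Ioo h.integrable ha hb

theorem sub_eq_integral (h : IsAntideriv L u g) {a b : ℝ} (ha : a ∈ Icc 0 L)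
    (hb : b ∈ Icc 0 L) : u b - u a = ∫ t in a..b, g t := by
  have h0 : (0 : ℝ) ∈ Icc 0 L := ⟨le_rfl, ha.1.trans ha.2⟩
  rw [h.eq_add_integral a ha, h.eq_add_integral b hb,
    ← intervalIntegral.integral_interval_sub_left (h.intervalIntegrable h0 hb)
      (h.intervalIntegrable h0 ha)]
  ring

theorem congr_left (h : IsAntideriv L u g) (huv : EqOn u v (Icc 0 L)) : IsAntideriv L v g := by
  refine ⟨h.integrable, fun x hx => ?_⟩
  rw [← huv hx, ← huv ⟨le_rfl, hx.1.trans hx.2⟩]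
  exact h.eq_add_integral x hx

theorem congr_right (h : IsAntideriv L u g) (hgk : g =ᵐ[vol L] k) : IsAntideriv L u k := by
  refine ⟨h.integrable.congr hgk, fun x hx => ?_⟩
  rw [h.eq_add_integral x hx, ← setIntegral_Ioo_eq_intervalIntegral hx.1,
    ← setIntegral_Ioo_eq_intervalIntegral hx.1]
  congr 1
  exact integral_congr_ae (ae_restrict_of_ae_restrict_of_subset (Ioo_subset_Ioo_right hx.2) hgk)

theorem absolutelyContinuous (h : IsAntideriv L u g) (hL : 0 ≤ L) :
    AbsolutelyContinuousOnInterval u 0 L := by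
  have h0 : (0 : ℝ) ∈ Icc 0 L := ⟨le_rfl, hL⟩
  have h1 : AbsolutelyContinuousOnInterval (fun x => ∫ t in 0..x, g t) 0 L :=
    (h.intervalIntegrable h0 ⟨hL, le_rfl⟩).absolutelyContinuousOnInterval_intervalIntegral
      (by simp)
  have h2 : AbsolutelyContinuousOnInterval (fun _ : ℝ => u 0) 0 L :=
    (contDiffOn_const).absolutelyContinuousOnInterval
  refine absolutelyContinuousOnInterval_of_dist_le (h2.add h1) one_pos fun x hx y hy => ?_
  rw [uIcc_of_le hL] at hx hy
  rw [one_mul, h.eq_add_integral x hx, h.eq_add_integral y hy]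
  rfl

theorem continuousOn (h : IsAntideriv L u g) : ContinuousOn u (Icc 0 L) := by
  rcases le_or_gt 0 L with hL | hL
  · simpa [uIcc_of_le hL] using (h.absolutelyContinuous hL).continuousOn
  · simp [Icc_eq_empty (not_le.2 hL)]

theorem ae_hasDerivAt (h : IsAntideriv L u g) :
    ∀ᵐ x ∂(vol L), HasDerivAt u (g x) x := by
  rw [ae_restrict_iff' measurableSet_Ioo]
  rcases le_or_gt 0 L with hL | hL
  swap
  · simp [Ioo_eq_empty (not_lt.2 hL.le)]
  have h0 : (0 : ℝ) ∈ Icc 0 L := ⟨le_rfl, hL⟩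
  filter_upwards [(h.intervalIntegrable h0 ⟨hL, le_rfl⟩).ae_hasDerivAt_integral] with x hx hxL
  have h1 := (hx (by rw [uIcc_of_le hL]; exact Ioo_subset_Icc_self hxL) 0 (by simp)).const_add (u 0)
  refine h1.congr_of_eventuallyEq ?_
  filter_upwards [isOpen_Ioo.mem_nhds hxL] with y hy
  exact h.eq_add_integral y (Ioo_subset_Icc_self hy)

/-- The fundamental theorem of calculus for absolutely continuous functions; it reduces products and
reciprocals to pointwise differentiation rules. -/
theorem of_absolutelyContinuous (hL : 0 ≤ L) (hu : AbsolutelyContinuousOnInterval u 0 L)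
    (hd : ∀ᵐ x ∂(vol L), HasDerivAt u (g x) x) : IsAntideriv L u g := by
  have h0 : (0 : ℝ) ∈ Icc 0 L := ⟨le_rfl, hL⟩
  have hd' : deriv u =ᵐ[vol L] g := hd.mono fun x hx => hx.deriv
  refine congr_right ⟨?_, fun x hx => ?_⟩ hd'
  · exact (intervalIntegrable_iff_integrableOn_Ioo_of_le hL).1 hu.intervalIntegrable_deriv
  · rw [(hu.mono _).integral_deriv_eq_sub]
    · ring
    · rw [uIcc_of_le hL, uIcc_of_le hx.1]
      exact Icc_subset_Icc_right hx.2

theorem of_contDiff (hL : 0 ≤ L) (hu : ContDiff ℝ 1 u) : IsAntideriv L u (deriv u) :=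
  of_absolutelyContinuous hL hu.contDiffOn.absolutelyContinuousOnInterval
    (.of_forall fun x => ((hu.differentiable one_ne_zero) x).hasDerivAt)

theorem mul (hL : 0 ≤ L) (hu : IsAntideriv L u g) (hv : IsAntideriv L v k) :
    IsAntideriv L (fun x => u x * v x) (fun x => g x * v x + u x * k x) := by
  refine of_absolutelyContinuous hL
    ((hu.absolutelyContinuous hL).mul (hv.absolutelyContinuous hL)) ?_
  filter_upwards [hu.ae_hasDerivAt, hv.ae_hasDerivAt] with x h1 h2
  exact h1.mul h2

theorem sub (hu : IsAntideriv L u g) (hv : IsAntideriv L v k) :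
    IsAntideriv L (u - v) (g - k) := by
  refine ⟨hu.integrable.sub hv.integrable, fun x hx => ?_⟩
  have h0 : (0 : ℝ) ∈ Icc 0 L := ⟨le_rfl, hx.1.trans hx.2⟩
  simp only [Pi.sub_apply]
  rw [intervalIntegral.integral_sub (hu.intervalIntegrable h0 hx) (hv.intervalIntegrable h0 hx),
    hu.eq_add_integral x hx, hv.eq_add_integral x hx]
  ring

theorem add (hu : IsAntideriv L u g) (hv : IsAntideriv L v k) :
    IsAntideriv L (u + v) (g + k) := by
  refine ⟨hu.integrable.add hv.integrable, fun x hx => ?_⟩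
  have h0 : (0 : ℝ) ∈ Icc 0 L := ⟨le_rfl, hx.1.trans hx.2⟩
  simp only [Pi.add_apply]
  rw [intervalIntegral.integral_add (hu.intervalIntegrable h0 hx) (hv.intervalIntegrable h0 hx),
    hu.eq_add_integral x hx, hv.eq_add_integral x hx]
  ring

theorem const_smul (c : ℝ) (hu : IsAntideriv L u g) : IsAntideriv L (c • u) (c • g) := by
  refine ⟨hu.integrable.smul c, fun x hx => ?_⟩
  simp only [Pi.smul_apply, smul_eq_mul, intervalIntegral.integral_const_mul]
  rw [hu.eq_add_integral x hx]
  ring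

theorem inv (hL : 0 ≤ L) (hu : IsAntideriv L u g) {α : ℝ} (hα : 0 < α)
    (h : ∀ x ∈ Icc 0 L, α ≤ u x) :
    IsAntideriv L (fun x => (u x)⁻¹) (fun x => -g x / u x ^ 2) := by
  refine of_absolutelyContinuous hL (absolutelyContinuousOnInterval_of_dist_le
    (hu.absolutelyContinuous hL) (inv_pos.2 (pow_pos hα 2)) fun x hx y hy => ?_) ?_
  · rw [uIcc_of_le hL] at hx hy
    have h1 := h x hx
    have h2 := h y hy
    have h1' := hα.trans_le h1
    have h2' := hα.trans_le h2
    rw [dist_inv_inv₀ h1'.ne' h2'.ne', Real.norm_of_nonneg h1'.le, Real.norm_of_nonneg h2'.le,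
      div_eq_inv_mul]
    refine mul_le_mul_of_nonneg_right (inv_anti₀ (pow_pos hα 2) ?_) dist_nonneg
    rw [pow_two]
    exact mul_le_mul h1 h2 hα.le h1'.le
  · filter_upwards [hu.ae_hasDerivAt, ae_restrict_mem measurableSet_Ioo] with x hx hxL
    exact hx.fun_inv (hα.trans_le (h x (Ioo_subset_Icc_self hxL))).ne'

theorem integral_mul_add_mul (hL : 0 ≤ L) (hu : IsAntideriv L u g) (hv : IsAntideriv L v k) :
    ∫ x in Ioo 0 L, (g x * v x + u x * k x) = u L * v L - u 0 * v 0 := by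
  rw [setIntegral_Ioo_eq_intervalIntegral hL]
  exact ((hu.mul hL hv).sub_eq_integral ⟨le_rfl, hL⟩ ⟨hL, le_rfl⟩).symm

theorem integrable_mul (hu : IsAntideriv L u g) (hk : IntegrableOn k (Ioo 0 L)) :
    IntegrableOn (fun x => u x * k x) (Ioo 0 L) := by
  rcases le_or_gt 0 L with hL | hL
  swap
  · simp [Ioo_eq_empty (not_lt.2 hL.le)]
  rw [← intervalIntegrable_iff_integrableOn_Ioo_of_le hL] at hk ⊢
  refine hk.continuousOn_mul ?_
  rw [uIcc_of_le hL]
  exact hu.continuousOn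

theorem integral_mul_deriv (hL : 0 ≤ L) (hu : IsAntideriv L u g) (hv : IsAntideriv L v k) :
    ∫ x in Ioo 0 L, u x * k x = u L * v L - u 0 * v 0 - ∫ x in Ioo 0 L, g x * v x := by
  rw [← integral_mul_add_mul hL hu hv, integral_add _ (hu.integrable_mul hv.integrable)]
  · ring
  · exact (hv.integrable_mul hu.integrable).congr (.of_forall fun x => mul_comm _ _)

end IsAntideriv

/-! ### Weak derivatives -/

theorem integrableOn_mul_of_hasCompactSupport {L : ℝ} {g φ : ℝ → ℝ}
    (hg : LocallyIntegrableOn g (Ioo 0 L)) (hφ : Continuous φ) (hc : HasCompactSupport φ)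
    (hs : tsupport φ ⊆ Ioo 0 L) : IntegrableOn (fun x => g x * φ x) (Ioo 0 L) := by
  have h1 : IntegrableOn g (tsupport φ) := hg.integrableOn_compact_subset hs hc
  have h2 : IntegrableOn (fun x => g x * φ x) (tsupport φ) :=
    h1.mul_continuousOn hφ.continuousOn hc
  refine h2.of_forall_sdiff_eq_zero measurableSet_Ioo fun x hx => ?_
  rw [image_eq_zero_of_notMem_tsupport hx.2, mul_zero]

theorem ae_eq_zero_of_integral_mul_eq_zero {L : ℝ} {g : ℝ → ℝ}
    (hg : LocallyIntegrableOn g (Ioo 0 L))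
    (h : ∀ φ : ℝ → ℝ, ContDiff ℝ ∞ φ → HasCompactSupport φ → tsupport φ ⊆ Ioo 0 L →
      ∫ x in Ioo 0 L, g x * φ x = 0) : ∀ᵐ x ∂(vol L), g x = 0 := by
  rw [ae_restrict_iff' measurableSet_Ioo]
  refine isOpen_Ioo.ae_eq_zero_of_integral_contDiff_smul_eq_zero hg fun φ h1 h2 h3 => ?_
  rw [← h φ h1 h2 h3, setIntegral_eq_integral_of_forall_compl_eq_zero]
  · simp only [smul_eq_mul, mul_comm]
  · intro x hx
    rw [image_eq_zero_of_notMem_tsupport fun hx' => hx (h3 hx'), mul_zero]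

theorem IsWeakDeriv.ae_eq {L : ℝ} {u g k : ℝ → ℝ} (hg : IsWeakDeriv L u g)
    (hk : IsWeakDeriv L u k) : g =ᵐ[vol L] k := by
  have h := ae_eq_zero_of_integral_mul_eq_zero (hg.2.1.sub hk.2.1) fun φ h1 h2 h3 => by
    simp only [Pi.sub_apply, sub_mul]
    rw [integral_sub (integrableOn_mul_of_hasCompactSupport hg.2.1 h1.continuous h2 h3)
      (integrableOn_mul_of_hasCompactSupport hk.2.1 h1.continuous h2 h3)]
    linarith [hg.2.2 φ h1 h2 h3, hk.2.2 φ h1 h2 h3]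
  filter_upwards [h] with x hx
  exact sub_eq_zero.1 hx

theorem IsWeakDeriv.isWeakDeriv_weakDeriv {L : ℝ} {u g : ℝ → ℝ} (hg : IsWeakDeriv L u g) :
    IsWeakDeriv L u (weakDeriv L u) := by
  have h : ∃ g, IsWeakDeriv L u g := ⟨g, hg⟩
  rw [weakDeriv, dif_pos h]
  exact h.choose_spec

theorem IsWeakDeriv.weakDeriv_ae_eq {L : ℝ} {u g : ℝ → ℝ} (hg : IsWeakDeriv L u g) :
    weakDeriv L u =ᵐ[vol L] g :=
  hg.isWeakDeriv_weakDeriv.ae_eq hg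

theorem IsWeakDeriv.sub {L : ℝ} {u v g k : ℝ → ℝ} (hg : IsWeakDeriv L u g)
    (hk : IsWeakDeriv L v k) : IsWeakDeriv L (u - v) (g - k) := by
  refine ⟨hg.1.sub hk.1, hg.2.1.sub hk.2.1, fun φ h1 h2 h3 => ?_⟩
  have hd : Continuous (deriv φ) := h1.continuous_deriv (by simp)
  have hs : tsupport (deriv φ) ⊆ Ioo 0 L := tsupport_deriv_subset.trans h3
  simp only [Pi.sub_apply, sub_mul]
  rw [integral_sub (integrableOn_mul_of_hasCompactSupport hg.1 hd h2.deriv hs)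
      (integrableOn_mul_of_hasCompactSupport hk.1 hd h2.deriv hs),
    integral_sub (integrableOn_mul_of_hasCompactSupport hg.2.1 h1.continuous h2 h3)
      (integrableOn_mul_of_hasCompactSupport hk.2.1 h1.continuous h2 h3),
    hg.2.2 φ h1 h2 h3, hk.2.2 φ h1 h2 h3]
  ring

theorem IsAntideriv.isWeakDeriv {L : ℝ} (hL : 0 ≤ L) {u g : ℝ → ℝ} (h : IsAntideriv L u g) :
    IsWeakDeriv L u g := by
  refine ⟨(h.continuousOn.mono Ioo_subset_Icc_self).locallyIntegrableOn measurableSet_Ioo,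
    h.integrable.locallyIntegrableOn, fun φ h1 _ h3 => ?_⟩
  have hz : ∀ x, x ∉ Ioo 0 L → φ x = 0 := fun x hx =>
    image_eq_zero_of_notMem_tsupport fun hx' => hx (h3 hx')
  rw [h.integral_mul_deriv hL (IsAntideriv.of_contDiff hL (h1.of_le (by simp))),
    hz 0 (by simp), hz L (by simp)]
  ring

/-- Du Bois-Reymond: for a fixed bump `ρ` of mass 1 and a test function `η` of mass `m`, `η - m ρ`
has mean zero, so it is the derivative of a test function and `w` annihilates it. Thus `∫ w η = m ∫
w ρ`, and the constant is `∫ w ρ`. -/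
theorem IsWeakDeriv.exists_ae_eq_const {L : ℝ} (hL : 0 < L) {w : ℝ → ℝ}
    (hw : IsWeakDeriv L w 0) : ∃ c : ℝ, ∀ᵐ x ∂(vol L), w x = c := by
  let θ : ContDiffBump (L / 2) := ⟨L / 8, L / 4, by linarith, by linarith⟩
  let ρ : ℝ → ℝ := θ.normed volume
  have hρs : ContDiff ℝ ∞ ρ := θ.contDiff_normed
  have hρc : HasCompactSupport ρ := θ.hasCompactSupport_normed
  have hρt : tsupport ρ = Icc (L / 4) (3 * L / 4) := by
    rw [θ.tsupport_normed_eq, Real.closedBall_eq_Icc]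
    change Icc (L / 2 - L / 4) (L / 2 + L / 4) = _
    congr 1 <;> ring
  have hρi : ∫ x, ρ x = 1 := θ.integral_normed
  have hρt' : tsupport ρ ⊆ Ioo 0 L := by
    rw [hρt]; intro x hx; exact ⟨by linarith [hx.1], by linarith [hx.2]⟩
  set c := ∫ x in Ioo 0 L, w x * ρ x with hc
  refine ⟨c, ?_⟩
  have hcst : LocallyIntegrableOn (fun _ : ℝ => c) (Ioo 0 L) :=
    continuousOn_const.locallyIntegrableOn measurableSet_Ioo
  have key := ae_eq_zero_of_integral_mul_eq_zero (g := fun x => w x - c) (hw.1.sub hcst) ?_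
  · filter_upwards [key] with x hx
    exact sub_eq_zero.1 hx
  intro η h1 h2 h3
  set m := ∫ x, η x with hm
  let ζ : ℝ → ℝ := fun x => η x - m * ρ x
  have hζs : ContDiff ℝ ∞ ζ := h1.sub (contDiff_const.mul hρs)
  let φ : ℝ → ℝ := fun x => ∫ t in 0..x, ζ t
  have hφd : ∀ x, HasDerivAt φ (ζ x) x := fun x =>
    intervalIntegral.integral_hasDerivAt_right (hζs.continuous.intervalIntegrable _ _)
      (hζs.continuous.stronglyMeasurableAtFilter _ _) hζs.continuous.continuousAt
  have hφd' : deriv φ = ζ := funext fun x => (hφd x).deriv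
  have hφs : ContDiff ℝ ∞ φ := by
    rw [contDiff_infty_iff_deriv, hφd']
    exact ⟨fun x => (hφd x).differentiableAt, hζs⟩
  obtain ⟨a, b, ha, hb, hK⟩ : ∃ a b, 0 < a ∧ b < L ∧ tsupport η ∪ tsupport ρ ⊆ Icc a b := by
    have hKc : IsCompact (tsupport η ∪ tsupport ρ) := h2.isCompact.union hρc.isCompact
    have hKn : (tsupport η ∪ tsupport ρ).Nonempty := by
      refine ⟨L / 2, Or.inr ?_⟩
      rw [hρt]; exact ⟨by linarith, by linarith⟩
    have hKL : tsupport η ∪ tsupport ρ ⊆ Ioo 0 L := union_subset h3 hρt'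
    exact ⟨_, _, (hKL (hKc.sInf_mem hKn)).1, (hKL (hKc.sSup_mem hKn)).2,
      fun x hx => ⟨csInf_le hKc.bddBelow hx, le_csSup hKc.bddAbove hx⟩⟩
  have hζz : ∀ x, x ∉ Icc a b → ζ x = 0 := fun x hx => by
    have e1 : η x = 0 := image_eq_zero_of_notMem_tsupport fun h => hx (hK (Or.inl h))
    have e2 : ρ x = 0 := image_eq_zero_of_notMem_tsupport fun h => hx (hK (Or.inr h))
    simp [ζ, e1, e2]
  have hζi : ∫ x, ζ x = 0 := by
    simp only [ζ]
    rw [integral_sub (h1.continuous.integrable_of_hasCompactSupport h2)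
      ((hρs.continuous.integrable_of_hasCompactSupport hρc).const_mul m), integral_const_mul, hρi]
    simp [hm]
  -- To the left of the support the integrand vanishes; to the right the integral is the full mass
  -- of `ζ`, which is zero.
  have hφz : ∀ x, x ∉ Icc a b → φ x = 0 := fun x hx => by
    rcases lt_or_ge x a with hxa | hxa
    · refine (intervalIntegral.integral_congr (g := fun _ => (0 : ℝ)) fun t ht => ?_).trans
        (by simp)
      refine hζz t fun h => ?_
      have : t ≤ max 0 x := ht.2
      exact absurd (h.1.trans this) (not_le.2 (max_lt ha hxa))
    · have hxb : b < x := not_le.1 fun h => hx ⟨hxa, h⟩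
      change ∫ t in 0..x, ζ t = 0
      rw [intervalIntegral.integral_eq_integral_of_support_subset, hζi]
      intro t ht
      have := not_not.1 fun h => ht (hζz t h)
      exact ⟨ha.trans_le this.1, this.2.trans hxb.le⟩
  have hφt : tsupport φ ⊆ Icc a b := by
    refine closure_minimal (fun x hx => ?_) isClosed_Icc
    exact not_not.1 fun h => hx (hφz x h)
  have hφ := hw.2.2 φ hφs (HasCompactSupport.of_support_subset_isCompact isCompact_Icc
    (subset_closure.trans hφt)) (hφt.trans fun x hx => ⟨ha.trans_le hx.1, hx.2.trans_lt hb⟩)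
  have i1 := integrableOn_mul_of_hasCompactSupport hw.1 h1.continuous h2 h3
  have i2 := integrableOn_mul_of_hasCompactSupport hw.1 hρs.continuous hρc hρt'
  have i3 := integrableOn_mul_of_hasCompactSupport hcst h1.continuous h2 h3
  have e1 : ∫ x in Ioo 0 L, w x * deriv φ x = (∫ x in Ioo 0 L, w x * η x) - m * c := by
    rw [hφd', hc, ← integral_const_mul, ← integral_sub i1 (i2.const_mul m)]
    refine integral_congr_ae (.of_forall fun x => ?_)
    simp only [ζ]; ring
  have e2 : ∫ x in Ioo 0 L, c * η x = m * c := by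
    rw [integral_const_mul, setIntegral_eq_integral_of_forall_compl_eq_zero, mul_comm]
    exact fun x hx => image_eq_zero_of_notMem_tsupport fun hx' => hx (h3 hx')
  simp only [sub_mul]
  rw [integral_sub i1 i3, e2, ← e1, hφ]
  simp

theorem IsWeakDeriv.exists_isAntideriv {L : ℝ} (hL : 0 < L) {u g : ℝ → ℝ}
    (h : IsWeakDeriv L u g) (hg : IntegrableOn g (Ioo 0 L)) :
    ∃ v, IsAntideriv L v g ∧ u =ᵐ[vol L] v := by
  have h1 : IsAntideriv L (fun x => ∫ t in 0..x, g t) g := ⟨hg, fun x _ => by simp⟩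
  have h2 := h.sub (h1.isWeakDeriv hL.le)
  rw [sub_self] at h2
  obtain ⟨c, hc⟩ := h2.exists_ae_eq_const hL
  refine ⟨fun x => c + ∫ t in 0..x, g t, ⟨hg, fun x _ => by simp⟩, ?_⟩
  filter_upwards [hc] with x hx
  simp only [Pi.sub_apply] at hx
  linarith

/-! ### Square integrable functions -/

theorem sq_integral_mul_le {α : Type*} [MeasurableSpace α] {μ : Measure α} {f g : α → ℝ}
    (hf : MemLp f 2 μ) (hg : MemLp g 2 μ) :
    (∫ x, f x * g x ∂μ) ^ 2 ≤ (∫ x, f x ^ 2 ∂μ) * ∫ x, g x ^ 2 ∂μ := by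
  have i1 := hf.integrable_sq
  have i2 := hg.integrable_sq
  have i3 : Integrable (fun x => f x * g x) μ := hf.integrable_mul hg
  have h := discrim_le_zero (a := ∫ x, g x ^ 2 ∂μ) (b := 2 * ∫ x, f x * g x ∂μ)
    (c := ∫ x, f x ^ 2 ∂μ) fun t => by
    have h0 : 0 ≤ ∫ x, (f x + t * g x) ^ 2 ∂μ := integral_nonneg fun x => sq_nonneg _
    have h1 : ∫ x, (f x + t * g x) ^ 2 ∂μ
        = ∫ x, (f x ^ 2 + 2 * t * (f x * g x) + t * t * g x ^ 2) ∂μ :=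
      integral_congr_ae (.of_forall fun x => by ring)
    have i4 : Integrable (fun x => f x ^ 2 + 2 * t * (f x * g x)) μ := i1.add (i3.const_mul _)
    rw [h1, integral_add i4 (i2.const_mul _),
      integral_add i1 (i3.const_mul _), integral_const_mul, integral_const_mul] at h0
    linarith
  rw [discrim] at h
  linarith

theorem normLp_nonneg (L : ℝ) (p : ENNReal) (g : ℝ → ℝ) : 0 ≤ normLp L p g :=
  ENNReal.toReal_nonneg

theorem normLp_congr {L : ℝ} {p : ENNReal} {f g : ℝ → ℝ} (h : f =ᵐ[vol L] g) :
    normLp L p f = normLp L p g := by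
  rw [normLp, normLp, eLpNorm_congr_ae h]

theorem normLp_two_sq {L : ℝ} {g : ℝ → ℝ} (hg : MemLp g 2 (vol L)) :
    normLp L 2 g ^ 2 = ∫ x in Ioo 0 L, g x ^ 2 := by
  have h0 : 0 ≤ ∫ x in Ioo 0 L, g x ^ 2 := integral_nonneg fun x => sq_nonneg _
  rw [normLp, hg.eLpNorm_eq_integral_rpow_norm (by simp) (by simp)]
  have h1 : ∫ x in Ioo 0 L, ‖g x‖ ^ (2 : ENNReal).toReal = ∫ x in Ioo 0 L, g x ^ 2 := by
    refine integral_congr_ae (.of_forall fun x => ?_)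
    simp
  rw [h1, ENNReal.toReal_ofReal (Real.rpow_nonneg h0 _)]
  simp only [ENNReal.toReal_ofNat]
  rw [← Real.rpow_natCast, ← Real.rpow_mul h0]
  norm_num

theorem normLp_two_le {L : ℝ} {g : ℝ → ℝ} {c : ℝ} (hg : MemLp g 2 (vol L)) (hc : 0 ≤ c)
    (h : ∫ x in Ioo 0 L, g x ^ 2 ≤ c ^ 2) : normLp L 2 g ≤ c := by
  rw [← normLp_two_sq hg] at h
  exact le_of_sq_le_sq h hc

theorem abs_integral_mul_le_normLp {L : ℝ} {f g : ℝ → ℝ} (hf : MemLp f 2 (vol L))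
    (hg : MemLp g 2 (vol L)) :
    |∫ x in Ioo 0 L, f x * g x| ≤ normLp L 2 f * normLp L 2 g := by
  refine abs_le_of_sq_le_sq ?_ (mul_nonneg (normLp_nonneg _ _ _) (normLp_nonneg _ _ _))
  rw [mul_pow, normLp_two_sq hf, normLp_two_sq hg]
  exact sq_integral_mul_le hf hg

theorem normLp_add_le {L : ℝ} {f g : ℝ → ℝ} (hf : MemLp f 2 (vol L))
    (hg : MemLp g 2 (vol L)) : normLp L 2 (f + g) ≤ normLp L 2 f + normLp L 2 g := by
  rw [normLp, normLp, normLp, ← ENNReal.toReal_add hf.eLpNorm_ne_top hg.eLpNorm_ne_top]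
  exact ENNReal.toReal_mono (ENNReal.add_ne_top.2 ⟨hf.eLpNorm_ne_top, hg.eLpNorm_ne_top⟩)
    (eLpNorm_add_le hf.1 hg.1 (by norm_num))

theorem normLp_sub_le {L : ℝ} {f g : ℝ → ℝ} (hf : MemLp f 2 (vol L))
    (hg : MemLp g 2 (vol L)) : normLp L 2 (f - g) ≤ normLp L 2 f + normLp L 2 g := by
  rw [sub_eq_add_neg]
  refine (normLp_add_le hf hg.neg).trans_eq ?_
  rw [normLp, normLp, normLp, eLpNorm_neg]

theorem normLp_le_mul_normLp {L c : ℝ} {f g : ℝ → ℝ} (hc : 0 ≤ c) (hg : MemLp g 2 (vol L))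
    (h : ∀ᵐ x ∂(vol L), |f x| ≤ c * |g x|) : normLp L 2 f ≤ c * normLp L 2 g := by
  have h1 := eLpNorm_le_mul_eLpNorm_of_ae_le_mul (f := f) (g := g) h 2
  have h2 := ENNReal.toReal_mono (ENNReal.mul_ne_top ENNReal.ofReal_ne_top hg.eLpNorm_ne_top) h1
  rwa [ENNReal.toReal_mul, ENNReal.toReal_ofReal hc] at h2

theorem normLp_const_mul {L c : ℝ} {g : ℝ → ℝ} :
    normLp L 2 (fun x => c * g x) = |c| * normLp L 2 g := by
  have := eLpNorm_const_smul c g 2 (vol L)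
  rw [normLp, normLp, show (fun x => c * g x) = c • g from rfl, this, ENNReal.toReal_mul]
  simp

theorem ae_abs_le_normLp_top {L : ℝ} {g : ℝ → ℝ} (hg : MemLp g ⊤ (vol L)) :
    ∀ᵐ x ∂(vol L), |g x| ≤ normLp L ⊤ g := by
  have h := ae_le_eLpNormEssSup (f := g) (μ := vol L)
  filter_upwards [h] with x hx
  have hne := hg.eLpNorm_ne_top
  rw [normLp]
  rw [eLpNorm_exponent_top] at hne ⊢
  have := ENNReal.toReal_mono hne hx
  simpa using this

theorem memLp_two_mul_of_bounded {L : ℝ} {a g : ℝ → ℝ} (ha : MemLp a ⊤ (vol L))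
    (hg : MemLp g 2 (vol L)) : MemLp (fun x => a x * g x) 2 (vol L) :=
  hg.mul (φ := a) ha

theorem IsAntideriv.memLp {L : ℝ} {u g : ℝ → ℝ} (h : IsAntideriv L u g) (p : ENNReal) :
    MemLp u p (vol L) := by
  obtain ⟨C, hC⟩ := isCompact_Icc.exists_bound_of_continuousOn h.continuousOn
  refine .of_bound ((h.continuousOn.mono Ioo_subset_Icc_self).aestronglyMeasurable
    measurableSet_Ioo) C ?_
  rw [ae_restrict_iff' measurableSet_Ioo]
  exact .of_forall fun x hx => hC x (Ioo_subset_Icc_self hx)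

theorem memLp_two_integrableOn {L : ℝ} {g : ℝ → ℝ} (hg : MemLp g 2 (vol L)) :
    IntegrableOn g (Ioo 0 L) :=
  hg.integrable (by norm_num)

/-! ### The space `H¹₀` -/

theorem MemH10.memLp_weakDeriv {L : ℝ} {u : ℝ → ℝ} (h : MemH10 L u) :
    MemLp (weakDeriv L u) 2 (vol L) := by
  obtain ⟨g, hg, hg2⟩ := h.1.2
  exact hg2.ae_eq hg.weakDeriv_ae_eq.symm

/-- Two functions continuous on `[0, L]` that agree almost everywhere agree at every point, end
points included. -/
theorem MemH10.isAntideriv {L : ℝ} (hL : 0 < L) {u : ℝ → ℝ} (h : MemH10 L u) :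
    IsAntideriv L u (weakDeriv L u) := by
  obtain ⟨g, hg, -⟩ := h.1.2
  obtain ⟨v, hv, huv⟩ := hg.isWeakDeriv_weakDeriv.exists_isAntideriv hL
    (memLp_two_integrableOn h.memLp_weakDeriv)
  refine hv.congr_left fun x hx => ?_
  refine (Measure.eqOn_Icc_of_ae_eq volume hL.ne ?_ h.2.1 hv.continuousOn hx).symm
  rwa [Measure.restrict_congr_set (Ioo_ae_eq_Icc (μ := volume)).symm]

theorem IsAntideriv.weakDeriv_ae_eq {L : ℝ} (hL : 0 < L) {u g : ℝ → ℝ} (h : IsAntideriv L u g) :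
    weakDeriv L u =ᵐ[vol L] g :=
  (h.isWeakDeriv hL.le).weakDeriv_ae_eq

theorem IsAntideriv.memH10 {L : ℝ} (hL : 0 < L) {u g : ℝ → ℝ} (h : IsAntideriv L u g)
    (hg : MemLp g 2 (vol L)) (h0 : u 0 = 0) (h1 : u L = 0) : MemH10 L u :=
  ⟨⟨h.memLp 2, g, h.isWeakDeriv hL.le, hg⟩, h.continuousOn, h0, h1⟩

theorem memH10_zero {L : ℝ} (hL : 0 < L) : MemH10 L 0 :=
  IsAntideriv.memH10 hL (g := 0) ⟨integrableOn_zero, fun x _ => by simp⟩ MemLp.zero rfl rfl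

theorem MemH10.add {L : ℝ} (hL : 0 < L) {u v : ℝ → ℝ} (hu : MemH10 L u) (hv : MemH10 L v) :
    MemH10 L (u + v) :=
  ((hu.isAntideriv hL).add (hv.isAntideriv hL)).memH10 hL
    (hu.memLp_weakDeriv.add hv.memLp_weakDeriv)
    (by simp [hu.2.2.1, hv.2.2.1]) (by simp [hu.2.2.2, hv.2.2.2])

theorem MemH10.const_smul {L : ℝ} (hL : 0 < L) (c : ℝ) {u : ℝ → ℝ} (hu : MemH10 L u) :
    MemH10 L (c • u) :=
  ((hu.isAntideriv hL).const_smul c).memH10 hL (hu.memLp_weakDeriv.const_smul c)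
    (by simp [hu.2.2.1]) (by simp [hu.2.2.2])

theorem MemH10.sub {L : ℝ} (hL : 0 < L) {u v : ℝ → ℝ} (hu : MemH10 L u) (hv : MemH10 L v) :
    MemH10 L (u - v) :=
  ((hu.isAntideriv hL).sub (hv.isAntideriv hL)).memH10 hL
    (hu.memLp_weakDeriv.sub hv.memLp_weakDeriv)
    (by simp [hu.2.2.1, hv.2.2.1]) (by simp [hu.2.2.2, hv.2.2.2])

theorem MemH10.weakDeriv_add {L : ℝ} (hL : 0 < L) {u v : ℝ → ℝ} (hu : MemH10 L u)
    (hv : MemH10 L v) : weakDeriv L (u + v) =ᵐ[vol L] weakDeriv L u + weakDeriv L v :=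
  ((hu.isAntideriv hL).add (hv.isAntideriv hL)).weakDeriv_ae_eq hL

theorem MemH10.weakDeriv_sub {L : ℝ} (hL : 0 < L) {u v : ℝ → ℝ} (hu : MemH10 L u)
    (hv : MemH10 L v) : weakDeriv L (u - v) =ᵐ[vol L] weakDeriv L u - weakDeriv L v :=
  ((hu.isAntideriv hL).sub (hv.isAntideriv hL)).weakDeriv_ae_eq hL

theorem MemH10.weakDeriv_const_smul {L : ℝ} (hL : 0 < L) (c : ℝ) {u : ℝ → ℝ}
    (hu : MemH10 L u) : weakDeriv L (c • u) =ᵐ[vol L] c • weakDeriv L u :=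
  ((hu.isAntideriv hL).const_smul c).weakDeriv_ae_eq hL

theorem MemH10.integral_weakDeriv_mul_self {L : ℝ} (hL : 0 < L) {u : ℝ → ℝ} (hu : MemH10 L u) :
    ∫ x in Ioo 0 L, weakDeriv L u x * u x = 0 := by
  have h := (hu.isAntideriv hL).integral_mul_deriv hL.le (hu.isAntideriv hL)
  rw [hu.2.2.1, hu.2.2.2] at h
  simp only [mul_comm (u _)] at h
  linarith

/-! ### Local Poincaré inequalities -/

theorem IsAntideriv.sq_sub_le {L : ℝ} {u g : ℝ → ℝ} (h : IsAntideriv L u g)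
    (hg : MemLp g 2 (vol L)) {l r x : ℝ} (hl : l ∈ Icc 0 L) (hr : r ∈ Icc 0 L)
    (hx : x ∈ Icc l r) : (u x - u l) ^ 2 ≤ (r - l) * ∫ t in Ioo l r, g t ^ 2 := by
  have hxL : x ∈ Icc 0 L := ⟨hl.1.trans hx.1, hx.2.trans hr.2⟩
  rw [h.sub_eq_integral hl hxL, ← setIntegral_Ioo_eq_intervalIntegral hx.1]
  have hg1 : MemLp g 2 (volume.restrict (Ioo l x)) :=
    hg.mono_measure (Measure.restrict_mono (Ioo_subset_Ioo hl.1 hxL.2) le_rfl)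
  have hgr : MemLp g 2 (volume.restrict (Ioo l r)) :=
    hg.mono_measure (Measure.restrict_mono (Ioo_subset_Ioo hl.1 hr.2) le_rfl)
  have h1 := sq_integral_mul_le (memLp_const (1 : ℝ)) hg1
  have h2 : ∫ t in Ioo l x, g t ^ 2 ≤ ∫ t in Ioo l r, g t ^ 2 :=
    setIntegral_mono_set hgr.integrable_sq (.of_forall fun t => sq_nonneg _)
      (Ioo_subset_Ioo_right hx.2).eventuallyLE
  have h3 : 0 ≤ ∫ t in Ioo l x, g t ^ 2 := integral_nonneg fun t => sq_nonneg _
  simp only [one_mul, one_pow, integral_const, smul_eq_mul, mul_one, measureReal_restrict_apply_univ,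
    Real.volume_real_Ioo_of_le hx.1] at h1
  have h4 : 0 ≤ x - l := sub_nonneg.2 hx.1
  have h5 : x - l ≤ r - l := by linarith [hx.2]
  exact h1.trans (mul_le_mul h5 h2 h3 (h4.trans h5))

theorem IsAntideriv.integral_sq_sub_le {L : ℝ} {u g : ℝ → ℝ} (h : IsAntideriv L u g)
    (hg : MemLp g 2 (vol L)) {l r : ℝ} (hl : l ∈ Icc 0 L) (hr : r ∈ Icc 0 L) (hlr : l ≤ r) :
    ∫ x in Ioo l r, (u x - u l) ^ 2 ≤ (r - l) ^ 2 * ∫ t in Ioo l r, g t ^ 2 := by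
  have hu : MemLp (fun x => u x - u l) 2 (volume.restrict (Ioo l r)) :=
    ((h.memLp 2).mono_measure (Measure.restrict_mono (Ioo_subset_Ioo hl.1 hr.2) le_rfl)).sub
      (memLp_const _)
  have h1 : ∫ x in Ioo l r, (u x - u l) ^ 2
      ≤ ∫ _ in Ioo l r, (r - l) * ∫ t in Ioo l r, g t ^ 2 :=
    setIntegral_mono_on hu.integrable_sq (integrable_const _) measurableSet_Ioo
      fun x hx => h.sq_sub_le hg hl hr (Ioo_subset_Icc_self hx)
  simp only [integral_const, smul_eq_mul, measureReal_restrict_apply_univ,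
    Real.volume_real_Ioo_of_le hlr] at h1
  linarith

/-- The mean is the best constant in `L²`, hence no worse than the value at the left end point. -/
theorem IsAntideriv.integral_sq_sub_average_le {L : ℝ} {u g : ℝ → ℝ} (h : IsAntideriv L u g)
    (hg : MemLp g 2 (vol L)) {l r : ℝ} (hl : l ∈ Icc 0 L) (hr : r ∈ Icc 0 L) (hlr : l < r) :
    ∫ x in Ioo l r, (u x - (∫ t in Ioo l r, u t) / (r - l)) ^ 2
      ≤ (r - l) ^ 2 * ∫ t in Ioo l r, g t ^ 2 := by
  refine le_trans ?_ (h.integral_sq_sub_le hg hl hr hlr.le)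
  set m := (∫ t in Ioo l r, u t) / (r - l) with hm
  have hu : MemLp u 2 (volume.restrict (Ioo l r)) :=
    (h.memLp 2).mono_measure (Measure.restrict_mono (Ioo_subset_Ioo hl.1 hr.2) le_rfl)
  have hum : MemLp (fun x => u x - m) 2 (volume.restrict (Ioo l r)) := hu.sub (memLp_const _)
  have hu1 : Integrable u (volume.restrict (Ioo l r)) := hu.integrable (by norm_num)
  have e1 : ∫ x in Ioo l r, (u x - m) = 0 := by
    rw [integral_sub hu1 (integrable_const _)]
    simp only [integral_const, smul_eq_mul, measureReal_restrict_apply_univ,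
      Real.volume_real_Ioo_of_le hlr.le, hm]
    field_simp [(sub_pos.2 hlr).ne']
    ring
  have e2 : ∫ x in Ioo l r, (u x - u l) ^ 2
      = ∫ x in Ioo l r, ((u x - m) ^ 2 + 2 * (m - u l) * (u x - m) + (m - u l) ^ 2) :=
    integral_congr_ae (.of_forall fun x => by ring)
  have i2 : Integrable (fun x => 2 * (m - u l) * (u x - m)) (volume.restrict (Ioo l r)) :=
    (hu1.sub (integrable_const _)).const_mul _
  have i3 : Integrable (fun x => (u x - m) ^ 2 + 2 * (m - u l) * (u x - m))
      (volume.restrict (Ioo l r)) := hum.integrable_sq.add i2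
  rw [e2, integral_add i3 (integrable_const _),
    integral_add hum.integrable_sq i2, integral_const_mul, e1]
  have : 0 ≤ ∫ _ in Ioo l r, (m - u l) ^ 2 := integral_nonneg fun _ => sq_nonneg _
  linarith

/-! ### Meshes -/

namespace Mesh

variable {L : ℝ} (T : Mesh L)

theorem left_lt_right (k : Fin T.n) : T.left k < T.right k :=
  T.strictMono k.castSucc_lt_succ

theorem node_mem (j : Fin (T.n + 1)) : T.node j ∈ Icc 0 L := by
  refine ⟨?_, ?_⟩
  · exact T.node_zero.symm.trans_le (T.strictMono.monotone (Fin.zero_le j))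
  · exact (T.strictMono.monotone (Fin.le_last j)).trans_eq T.node_last

theorem left_mem (k : Fin T.n) : T.left k ∈ Icc 0 L := T.node_mem _

theorem right_mem (k : Fin T.n) : T.right k ∈ Icc 0 L := T.node_mem _

theorem Ioo_subset (k : Fin T.n) : Ioo (T.left k) (T.right k) ⊆ Ioo 0 L :=
  Ioo_subset_Ioo (T.left_mem k).1 (T.right_mem k).2

theorem length_le_size (k : Fin T.n) : T.right k - T.left k ≤ T.size :=
  le_ciSup (f := fun k => T.right k - T.left k) (finite_range _).bddAbove k

theorem size_nonneg : 0 ≤ T.size :=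
  Real.iSup_nonneg fun k => (sub_pos.2 (T.left_lt_right k)).le

theorem ae_restrict_element {p : ℝ → Prop} (h : ∀ᵐ x ∂(vol L), p x) (k : Fin T.n) :
    ∀ᵐ x ∂(volume.restrict (Ioo (T.left k) (T.right k))), p x :=
  ae_restrict_of_ae_restrict_of_subset (T.Ioo_subset k) h

theorem integrableOn_element {F : ℝ → ℝ} (hF : IntegrableOn F (Ioo 0 L)) (k : Fin T.n) :
    IntegrableOn F (Ioo (T.left k) (T.right k)) :=
  hF.mono_set (T.Ioo_subset k)

theorem sum_integral {F : ℝ → ℝ} (hF : IntegrableOn F (Ioo 0 L)) :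
    ∑ k, ∫ x in Ioo (T.left k) (T.right k), F x = ∫ x in Ioo 0 L, F x := by
  -- The default value `L` keeps every term of the sequence in `[0, L]`, so that integrability needs
  -- no index bound.
  let a : ℕ → ℝ := fun j => if h : j < T.n + 1 then T.node ⟨j, h⟩ else L
  have hL : (0 : ℝ) ≤ L := (T.node_mem 0).1.trans (T.node_mem 0).2
  have ha : ∀ j, a j ∈ Icc 0 L := fun j => by
    by_cases h : j < T.n + 1
    · simp only [a, h, dif_pos]; exact T.node_mem _
    · simp only [a, h, dif_neg, not_false_eq_true]; exact ⟨hL, le_rfl⟩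
  have h1 := intervalIntegral.sum_integral_adjacent_intervals (f := F) (μ := volume) (a := a)
    (n := T.n) fun k _ => intervalIntegrable_of_integrableOn_Ioo hF (ha _) (ha _)
  have e0 : a 0 = 0 := by simp [a, ← T.node_zero]
  have e1 : a T.n = L := by
    simp only [a, Nat.lt_succ_self, dif_pos]; exact T.node_last
  rw [e0, e1, ← setIntegral_Ioo_eq_intervalIntegral hL, Finset.sum_range] at h1
  rw [← h1]
  refine Finset.sum_congr rfl fun k _ => ?_
  have el : a k = T.left k := by
    simp only [a, k.2.trans (Nat.lt_succ_self _), dif_pos]; rfl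
  have er : a (k + 1) = T.right k := by
    simp only [a, Nat.succ_lt_succ k.2, dif_pos]; rfl
  rw [setIntegral_Ioo_eq_intervalIntegral (T.left_lt_right k).le, el, er]

theorem integral_le_of_element_le {F G : ℝ → ℝ} (hF : IntegrableOn F (Ioo 0 L))
    (hG : IntegrableOn G (Ioo 0 L))
    (h : ∀ k, ∫ x in Ioo (T.left k) (T.right k), F x ≤ ∫ x in Ioo (T.left k) (T.right k), G x) :
    ∫ x in Ioo 0 L, F x ≤ ∫ x in Ioo 0 L, G x := by
  rw [← T.sum_integral hF, ← T.sum_integral hG]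
  exact Finset.sum_le_sum fun k _ => h k

theorem eq_of_increments_eq {F : ℝ → ℝ} {y : Fin (T.n + 1) → ℝ} (h0 : F 0 = y 0)
    (h : ∀ k, F (T.right k) - F (T.left k) = y k.succ - y k.castSucc) (j : Fin (T.n + 1)) :
    F (T.node j) = y j := by
  induction j using Fin.induction with
  | zero => rw [T.node_zero, h0]
  | succ k ih =>
    have := h k
    rw [left, right, ih] at this
    linarith

/-! ### Step functions -/

/-- The function equal to `s k` on the element `k`. -/
noncomputable def step (s : Fin T.n → ℝ) : ℝ → ℝ :=
  fun x => ∑ k, (Ioc (T.left k) (T.right k)).indicator (fun _ => s k) x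

/-- The half-open elements are disjoint, so a single term of the sum survives, also at the right end
point. -/
theorem step_apply (s : Fin T.n → ℝ) {k : Fin T.n} {x : ℝ}
    (hx : x ∈ Ioc (T.left k) (T.right k)) : T.step s x = s k := by
  rw [step, Finset.sum_eq_single k]
  · exact indicator_of_mem hx _
  · intro j _ hjk
    refine indicator_of_notMem (fun hxj => ?_) _
    rcases lt_or_gt_of_ne hjk with h | h
    · have : T.right j ≤ T.left k := T.strictMono.monotone (Fin.succ_le_castSucc_iff.2 h)
      linarith [hx.1, hxj.2]
    · have : T.right k ≤ T.left j := T.strictMono.monotone (Fin.succ_le_castSucc_iff.2 h)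
      linarith [hxj.1, hx.2]
  · simp

theorem memLp_step (s : Fin T.n → ℝ) (p : ENNReal) : MemLp (T.step s) p (vol L) :=
  memLp_finsetSum _ fun _ _ => memLp_indicator_const p measurableSet_Ioc _
    (Or.inr (measure_ne_top _ _))

end Mesh

/-! ### `P¹` functions, nodal interpolation and its error -/

theorem IsAntideriv.eq_affine {L : ℝ} {u g : ℝ → ℝ} (h : IsAntideriv L u g) {l r s : ℝ}
    (hl : l ∈ Icc 0 L) (hr : r ∈ Icc 0 L) (hg : ∀ x ∈ Ioc l r, g x = s) {x : ℝ}
    (hx : x ∈ Icc l r) : u x = s * x + (u l - s * l) := by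
  have h1 := h.sub_eq_integral hl (b := x) ⟨hl.1.trans hx.1, hx.2.trans hr.2⟩
  rw [← setIntegral_Ioo_eq_intervalIntegral hx.1,
    setIntegral_congr_fun measurableSet_Ioo (g := fun _ => s)
      fun t ht => hg t ⟨ht.1, ht.2.le.trans hx.2⟩] at h1
  simp only [integral_const, smul_eq_mul, measureReal_restrict_apply_univ,
    Real.volume_real_Ioo_of_le hx.1] at h1
  linarith

theorem MemP1.exists_weakDeriv_eq {L : ℝ} (hL : 0 < L) {T : Mesh L} {v : ℝ → ℝ}
    (hv : MemP1 T v) (k : Fin T.n) :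
    ∃ p : ℝ, ∀ᵐ x ∂(volume.restrict (Ioo (T.left k) (T.right k))), weakDeriv L v x = p := by
  obtain ⟨p, q, hpq⟩ := hv.2 k
  refine ⟨p, ?_⟩
  filter_upwards [T.ae_restrict_element (hv.1.isAntideriv hL).ae_hasDerivAt k,
    ae_restrict_mem measurableSet_Ioo] with x hx hxk
  have h1 : HasDerivAt v p x := by
    have h2 : HasDerivAt (fun x => p * x + q) p x := by
      simpa using ((hasDerivAt_id x).const_mul p).add_const q
    refine h2.congr_of_eventuallyEq ?_
    filter_upwards [isOpen_Ioo.mem_nhds hxk] with y hy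
    exact hpq y (Ioo_subset_Icc_self hy)
  exact hx.unique h1

theorem memP1_zero {L : ℝ} (hL : 0 < L) (T : Mesh L) : MemP1 T 0 :=
  ⟨memH10_zero hL, fun _ => ⟨0, 0, fun x _ => by simp⟩⟩

theorem MemP1.add {L : ℝ} (hL : 0 < L) {T : Mesh L} {u v : ℝ → ℝ} (hu : MemP1 T u)
    (hv : MemP1 T v) : MemP1 T (u + v) := by
  refine ⟨hu.1.add hL hv.1, fun k => ?_⟩
  obtain ⟨p, q, h⟩ := hu.2 k
  obtain ⟨p', q', h'⟩ := hv.2 k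
  exact ⟨p + p', q + q', fun x hx => by rw [Pi.add_apply, h x hx, h' x hx]; ring⟩

theorem MemP1.const_smul {L : ℝ} (hL : 0 < L) {T : Mesh L} (c : ℝ) {u : ℝ → ℝ}
    (hu : MemP1 T u) : MemP1 T (c • u) := by
  refine ⟨hu.1.const_smul hL c, fun k => ?_⟩
  obtain ⟨p, q, h⟩ := hu.2 k
  exact ⟨c * p, c * q, fun x hx => by rw [Pi.smul_apply, smul_eq_mul, h x hx]; ring⟩

theorem MemP1.sub {L : ℝ} (hL : 0 < L) {T : Mesh L} {u v : ℝ → ℝ} (hu : MemP1 T u)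
    (hv : MemP1 T v) : MemP1 T (u - v) := by
  have h := hu.add hL (hv.const_smul hL (-1))
  rwa [neg_one_smul, ← sub_eq_add_neg] at h

/-- The nodal interpolant. -/
theorem MemH10.exists_interpolant {L : ℝ} (hL : 0 < L) (T : Mesh L) {u : ℝ → ℝ}
    (hu : MemH10 L u) :
    ∃ v, MemP1 T v ∧ (∀ j, v (T.node j) = u (T.node j)) ∧
      weakDeriv L v =ᵐ[vol L]
        T.step fun k => (u (T.right k) - u (T.left k)) / (T.right k - T.left k) := by
  set s : Fin T.n → ℝ := fun k => (u (T.right k) - u (T.left k)) / (T.right k - T.left k) with hs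
  have hv : IsAntideriv L (fun x => ∫ t in 0..x, T.step s t) (T.step s) :=
    ⟨memLp_two_integrableOn (T.memLp_step s 2), fun x _ => by simp⟩
  set v : ℝ → ℝ := fun x => ∫ t in 0..x, T.step s t with hvdef
  have h0 : v 0 = 0 := by simp [hvdef]
  have haff : ∀ k, ∀ x ∈ Icc (T.left k) (T.right k),
      v x = s k * x + (v (T.left k) - s k * T.left k) := fun k x hx =>
    hv.eq_affine (T.left_mem k) (T.right_mem k) (fun t ht => T.step_apply s ht) hx
  have hnode : ∀ j, v (T.node j) = u (T.node j) := by
    refine T.eq_of_increments_eq (y := fun j => u (T.node j)) ?_ fun k => ?_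
    · rw [h0, T.node_zero, hu.2.2.1]
    · have hlr := T.left_lt_right k
      rw [haff k _ ⟨hlr.le, le_rfl⟩]
      have : s k * (T.right k - T.left k) = u (T.right k) - u (T.left k) :=
        div_mul_cancel₀ _ (sub_pos.2 hlr).ne'
      change _ = u (T.right k) - u (T.left k)
      linarith
  refine ⟨v, ⟨hv.memH10 hL (T.memLp_step s 2) h0 ?_, fun k => ⟨_, _, haff k⟩⟩, hnode,
    hv.weakDeriv_ae_eq hL⟩
  rw [← T.node_last, hnode, T.node_last, hu.2.2.2]

/-- Poincaré inequality for functions that vanish at the nodes. -/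
theorem MemH10.normLp_le_size_mul {L : ℝ} (hL : 0 < L) (T : Mesh L) {z : ℝ → ℝ}
    (hz : MemH10 L z) (h0 : ∀ j, z (T.node j) = 0) :
    normLp L 2 z ≤ T.size * normLp L 2 (weakDeriv L z) := by
  have ha := hz.isAntideriv hL
  have hg := hz.memLp_weakDeriv
  refine normLp_two_le (ha.memLp 2) (mul_nonneg T.size_nonneg (normLp_nonneg _ _ _)) ?_
  rw [mul_pow, normLp_two_sq hg, ← integral_const_mul]
  refine T.integral_le_of_element_le (ha.memLp 2).integrable_sq
    (hg.integrable_sq.const_mul _) fun k => ?_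
  have hlr := T.left_lt_right k
  have h1 := ha.integral_sq_sub_le hg (T.left_mem k) (T.right_mem k) hlr.le
  have h2 : z (T.left k) = 0 := h0 _
  simp only [h2, sub_zero] at h1
  rw [integral_const_mul]
  refine h1.trans (mul_le_mul_of_nonneg_right ?_ (integral_nonneg fun x => sq_nonneg _))
  exact pow_le_pow_left₀ (sub_nonneg.2 hlr.le) (T.length_le_size k) 2

/-- The interpolation error in `H¹`, for a function whose derivative has a square integrable weak
derivative. -/
theorem MemH10.normLp_sub_step_le {L : ℝ} (hL : 0 < L) (T : Mesh L) {u p r : ℝ → ℝ}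
    (hu : MemH10 L u) (hup : weakDeriv L u =ᵐ[vol L] p) (hp : IsAntideriv L p r)
    (hr : MemLp r 2 (vol L)) :
    normLp L 2 (weakDeriv L u -
        T.step fun k => (u (T.right k) - u (T.left k)) / (T.right k - T.left k))
      ≤ T.size * normLp L 2 r := by
  set s : Fin T.n → ℝ := fun k => (u (T.right k) - u (T.left k)) / (T.right k - T.left k) with hs
  have hm : MemLp (weakDeriv L u - T.step s) 2 (vol L) :=
    hu.memLp_weakDeriv.sub (T.memLp_step s 2)
  refine normLp_two_le hm (mul_nonneg T.size_nonneg (normLp_nonneg _ _ _)) ?_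
  rw [mul_pow, normLp_two_sq hr, ← integral_const_mul]
  refine T.integral_le_of_element_le hm.integrable_sq (hr.integrable_sq.const_mul _) fun k => ?_
  have hlr := T.left_lt_right k
  have hup' := T.ae_restrict_element hup k
  -- The slope of the interpolant is the mean of `u'` on the element, so the Poincaré inequality
  -- with mean value applies to `p`.
  have hsk : s k = (∫ t in Ioo (T.left k) (T.right k), p t) / (T.right k - T.left k) := by
    rw [← integral_congr_ae hup', setIntegral_Ioo_eq_intervalIntegral hlr.le,
      ← (hu.isAntideriv hL).sub_eq_integral (T.left_mem k) (T.right_mem k)]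
  have h1 := hp.integral_sq_sub_average_le hr (T.left_mem k) (T.right_mem k) hlr
  rw [← hsk] at h1
  have h2 : ∫ x in Ioo (T.left k) (T.right k), (weakDeriv L u - T.step s) x ^ 2
      = ∫ x in Ioo (T.left k) (T.right k), (p x - s k) ^ 2 := by
    refine integral_congr_ae ?_
    filter_upwards [hup', ae_restrict_mem measurableSet_Ioo] with x hx hxk
    simp only [Pi.sub_apply]
    rw [hx, T.step_apply s ⟨hxk.1, hxk.2.le⟩]
  rw [h2, integral_const_mul]
  refine h1.trans (mul_le_mul_of_nonneg_right ?_ (integral_nonneg fun x => sq_nonneg _))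
  exact pow_le_pow_left₀ (sub_nonneg.2 hlr.le) (T.length_le_size k) 2

/-! ### Refinements -/

namespace Mesh.Refines

variable {L : ℝ} {Th TH : Mesh L}

/-- A coarse node is a fine node, so it never lies inside a fine element. -/
theorem node_le_or_le_node (h : Th.Refines TH) (e : Fin Th.n) (j : Fin (TH.n + 1)) :
    TH.node j ≤ Th.left e ∨ Th.right e ≤ TH.node j := by
  obtain ⟨m, hm⟩ := h (mem_range_self j)
  rw [← hm]
  rcases le_or_gt m e.castSucc with hme | hme
  · exact Or.inl (Th.strictMono.monotone hme)
  · exact Or.inr (Th.strictMono.monotone (Fin.castSucc_lt_iff_succ_le.1 hme))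

theorem element_cases (h : Th.Refines TH) (e : Fin Th.n) (k : Fin TH.n) :
    (TH.left k ≤ Th.left e ∧ Th.right e ≤ TH.right k) ∨
      Th.right e ≤ TH.left k ∨ TH.right k ≤ Th.left e := by
  have h1 : TH.left k ≤ Th.left e ∨ Th.right e ≤ TH.left k := h.node_le_or_le_node e _
  have h2 : TH.right k ≤ Th.left e ∨ Th.right e ≤ TH.right k := h.node_le_or_le_node e _
  tauto

/-- A coarse step function is constant on each fine element; the right end point, which belongs to
the half-open element, is the sample point. -/
theorem step_eq (h : Th.Refines TH) (c : Fin TH.n → ℝ) (e : Fin Th.n) {x : ℝ}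
    (hx : x ∈ Ioc (Th.left e) (Th.right e)) : TH.step c x = TH.step c (Th.right e) := by
  have hlr := Th.left_lt_right e
  refine Finset.sum_congr rfl fun k _ => ?_
  rcases h.element_cases e k with h1 | h1 | h1
  · rw [indicator_of_mem (mem_Ioc.2 ⟨h1.1.trans_lt hx.1, hx.2.trans h1.2⟩),
      indicator_of_mem (mem_Ioc.2 ⟨h1.1.trans_lt hlr, h1.2⟩)]
  · rw [indicator_of_notMem fun hh => absurd hh.1 (not_lt.2 (hx.2.trans h1)),
      indicator_of_notMem fun hh => absurd hh.1 (not_lt.2 h1)]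
  · rw [indicator_of_notMem fun hh => absurd hh.2 (not_le.2 (h1.trans_lt hx.1)),
      indicator_of_notMem fun hh => absurd hh.2 (not_le.2 (h1.trans_lt hlr))]

theorem integral_element_congr (h : Th.Refines TH) (k : Fin TH.n) {F G : ℝ → ℝ}
    (hF : IntegrableOn F (Ioo 0 L)) (hG : IntegrableOn G (Ioo 0 L))
    (hFG : ∀ e, ∫ x in Ioo (Th.left e) (Th.right e), F x
      = ∫ x in Ioo (Th.left e) (Th.right e), G x) :
    ∫ x in Ioo (TH.left k) (TH.right k), F x = ∫ x in Ioo (TH.left k) (TH.right k), G x := by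
  have key : ∀ f : ℝ → ℝ, IntegrableOn f (Ioo 0 L) →
      ∫ x in Ioo (TH.left k) (TH.right k), f x = ∑ e, ∫ x in Ioo (Th.left e) (Th.right e),
        (Ioo (TH.left k) (TH.right k)).indicator f x := fun f hf => by
    have hi : IntegrableOn ((Ioo (TH.left k) (TH.right k)).indicator f) (Ioo 0 L) :=
      hf.indicator measurableSet_Ioo
    rw [Th.sum_integral hi, setIntegral_indicator measurableSet_Ioo,
      inter_eq_self_of_subset_right (TH.Ioo_subset k)]
  rw [key F hF, key G hG]
  refine Finset.sum_congr rfl fun e _ => ?_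
  rcases h.element_cases e k with h1 | h1
  · have h2 : ∀ f : ℝ → ℝ, ∫ x in Ioo (Th.left e) (Th.right e),
        (Ioo (TH.left k) (TH.right k)).indicator f x
          = ∫ x in Ioo (Th.left e) (Th.right e), f x := fun f =>
      setIntegral_congr_fun measurableSet_Ioo fun x hx =>
        indicator_of_mem (mem_Ioo.2 ⟨h1.1.trans_lt hx.1, hx.2.trans_le h1.2⟩) f
    rw [h2, h2, hFG]
  · have h2 : ∀ f : ℝ → ℝ, ∫ x in Ioo (Th.left e) (Th.right e),
        (Ioo (TH.left k) (TH.right k)).indicator f x = 0 := fun f =>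
      setIntegral_eq_zero_of_forall_eq_zero fun x hx => indicator_of_notMem (fun hh => by
        rcases h1 with h1 | h1
        · linarith [hx.2, hh.1]
        · linarith [hx.1, hh.2]) f
    rw [h2, h2]

theorem exists_fine_element (h : Th.Refines TH) (k : Fin TH.n) :
    ∃ e : Fin Th.n, TH.left k = Th.left e ∧ Th.right e ≤ TH.right k := by
  obtain ⟨m, hm⟩ := h (mem_range_self k.castSucc)
  have hlr := TH.left_lt_right k
  have hmL : m ≠ Fin.last Th.n := fun hh => by
    rw [hh, Th.node_last] at hm
    exact absurd ((TH.right_mem k).2.trans_eq hm) (not_le.2 hlr)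
  refine ⟨m.castPred hmL, ?_, ?_⟩
  · rw [Mesh.left, Mesh.left, Fin.castSucc_castPred, hm]
  · rcases h.node_le_or_le_node (m.castPred hmL) k.succ with h1 | h1
    · rw [Mesh.left, Fin.castSucc_castPred, hm] at h1
      exact absurd h1 (not_le.2 hlr)
    · exact h1

end Mesh.Refines

/-! ### The multiscale space -/

/-- An explicit solution. Fine `P¹` functions have constant slopes on fine elements, so only the
integrals `a e` of `A` enter. The slope `c k * ρ e`, with `ρ e` the inverse of the mean of `A` on
`e`, makes the mean flux constant on the coarse element `k`, so the local form is `c k` times the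
integral of `v'`, which vanishes. The factor `c k` is fixed by the prescribed nodal increments. -/
theorem exists_isMsBasis {L α₁ α₂ : ℝ} (hL : 0 < L) (hα : 0 < α₁) {A : ℝ → ℝ}
    (hA : MemLp A ⊤ (vol L)) (hA' : ∀ᵐ x ∂(vol L), α₁ ≤ A x ∧ A x ≤ α₂) {TH Th : Mesh L}
    (hR : Th.Refines TH) {i : Fin (TH.n + 1)} (hi0 : i ≠ 0) (hiL : i ≠ Fin.last TH.n) :
    ∃ ψ, IsMsBasis A TH Th i ψ := by
  have hAi : IntegrableOn A (Ioo 0 L) := hA.integrable le_top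
  -- the slopes of the harmonic coordinate
  set a : Fin Th.n → ℝ := fun e => ∫ x in Ioo (Th.left e) (Th.right e), A x with ha
  have ha0 : ∀ e, 0 < a e := fun e => by
    have hlr := Th.left_lt_right e
    have h1 : ∫ _ in Ioo (Th.left e) (Th.right e), α₁ ≤ a e :=
      setIntegral_mono_ae_restrict (by simp) (Th.integrableOn_element hAi e)
        ((Th.ae_restrict_element hA' e).mono fun x hx => hx.1)
    simp only [integral_const, smul_eq_mul, measureReal_restrict_apply_univ,
      Real.volume_real_Ioo_of_le hlr.le] at h1
    exact (mul_pos (sub_pos.2 hlr) hα).trans_le h1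
  set ρ : Fin Th.n → ℝ := fun e => (Th.right e - Th.left e) / a e with hρ
  have hρ0 : ∀ e, 0 < ρ e := fun e => div_pos (sub_pos.2 (Th.left_lt_right e)) (ha0 e)
  have hρi : IntegrableOn (Th.step ρ) (Ioo 0 L) := memLp_two_integrableOn (Th.memLp_step ρ 2)
  have hstep0 : ∀ x, 0 ≤ Th.step ρ x := fun x =>
    Finset.sum_nonneg fun e _ => indicator_nonneg (fun _ _ => (hρ0 e).le) x
  have hI : ∀ k, 0 < ∫ x in Ioo (TH.left k) (TH.right k), Th.step ρ x := fun k => by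
    obtain ⟨e, he1, he2⟩ := hR.exists_fine_element k
    have hlr := Th.left_lt_right e
    have h1 : ∫ x in Ioo (Th.left e) (Th.right e), Th.step ρ x
        ≤ ∫ x in Ioo (TH.left k) (TH.right k), Th.step ρ x :=
      setIntegral_mono_set (TH.integrableOn_element hρi k) (.of_forall hstep0)
        (Ioo_subset_Ioo he1.le he2).eventuallyLE
    rw [setIntegral_congr_fun measurableSet_Ioo (g := fun _ => ρ e)
      fun x hx => Th.step_apply ρ ⟨hx.1, hx.2.le⟩] at h1
    simp only [integral_const, smul_eq_mul, measureReal_restrict_apply_univ,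
      Real.volume_real_Ioo_of_le hlr.le] at h1
    exact (mul_pos (sub_pos.2 hlr) (hρ0 e)).trans_le h1
  let y : Fin (TH.n + 1) → ℝ := fun j => if j = i then 1 else 0
  set c : Fin TH.n → ℝ := fun k =>
    (y k.succ - y k.castSucc) / ∫ x in Ioo (TH.left k) (TH.right k), Th.step ρ x with hc
  set D : ℝ → ℝ := fun x => TH.step c x * Th.step ρ x with hD
  have hD2 : MemLp D 2 (vol L) := memLp_two_mul_of_bounded (TH.memLp_step c ⊤) (Th.memLp_step ρ 2)
  have hψ : IsAntideriv L (fun x => ∫ t in 0..x, D t) D :=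
    ⟨memLp_two_integrableOn hD2, fun x _ => by simp⟩
  set ψ : ℝ → ℝ := fun x => ∫ t in 0..x, D t with hψdef
  have h0 : ψ 0 = 0 := by simp [hψdef]
  have hnode : ∀ j, ψ (TH.node j) = y j := by
    refine TH.eq_of_increments_eq ?_ fun k => ?_
    · simp only [h0, y, hi0.symm, if_false]
    · rw [hψ.sub_eq_integral (TH.left_mem k) (TH.right_mem k),
        ← setIntegral_Ioo_eq_intervalIntegral (TH.left_lt_right k).le,
        setIntegral_congr_fun measurableSet_Ioo (g := fun x => c k * Th.step ρ x) fun x hx => by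
          simp only [hD]; rw [TH.step_apply c ⟨hx.1, hx.2.le⟩],
        integral_const_mul]
      exact div_mul_cancel₀ _ (hI k).ne'
  have hψL : ψ L = 0 := by
    rw [← TH.node_last, hnode]
    simp only [y, hiL.symm, if_false]
  have hDe : ∀ e, ∀ x ∈ Ioc (Th.left e) (Th.right e), D x = TH.step c (Th.right e) * ρ e :=
    fun e x hx => by simp only [hD]; rw [hR.step_eq c e hx, Th.step_apply ρ hx]
  refine ⟨ψ, ⟨hψ.memH10 hL hD2 h0 hψL, fun e => ⟨_, _, fun x hx =>
    hψ.eq_affine (Th.left_mem e) (Th.right_mem e) (hDe e) hx⟩⟩, hnode, fun k v hv hvl hvr => ?_⟩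
  have hv2 := hv.1.memLp_weakDeriv
  have hvi := memLp_two_integrableOn hv2
  have e1 : ∫ x in Ioo (TH.left k) (TH.right k), A x * weakDeriv L ψ x * weakDeriv L v x
      = ∫ x in Ioo (TH.left k) (TH.right k),
        c k * (A x * (Th.step ρ x * weakDeriv L v x)) := by
    refine integral_congr_ae ?_
    filter_upwards [TH.ae_restrict_element (hψ.weakDeriv_ae_eq hL) k,
      ae_restrict_mem measurableSet_Ioo] with x hx hxk
    rw [hx, hD]
    simp only []
    rw [TH.step_apply c ⟨hxk.1, hxk.2.le⟩]
    ring
  have hF : IntegrableOn (fun x => A x * (Th.step ρ x * weakDeriv L v x)) (Ioo 0 L) :=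
    memLp_two_integrableOn
      (memLp_two_mul_of_bounded hA (memLp_two_mul_of_bounded (Th.memLp_step ρ ⊤) hv2))
  rw [e1, integral_const_mul, hR.integral_element_congr k hF hvi fun e => ?_,
    setIntegral_Ioo_eq_intervalIntegral (TH.left_lt_right k).le,
    ← (hv.1.isAntideriv hL).sub_eq_integral (TH.left_mem k) (TH.right_mem k), hvl, hvr]
  · simp
  · obtain ⟨p, hp⟩ := hv.exists_weakDeriv_eq hL e
    have hlr := Th.left_lt_right e
    have e2 : ∫ x in Ioo (Th.left e) (Th.right e), A x * (Th.step ρ x * weakDeriv L v x)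
        = ∫ x in Ioo (Th.left e) (Th.right e), A x * (ρ e * p) := by
      refine integral_congr_ae ?_
      filter_upwards [hp, ae_restrict_mem measurableSet_Ioo] with x hx hxe
      rw [hx, Th.step_apply ρ ⟨hxe.1, hxe.2.le⟩]
    rw [e2, integral_mul_const, integral_congr_ae hp]
    simp only [integral_const, smul_eq_mul, measureReal_restrict_apply_univ,
      Real.volume_real_Ioo_of_le hlr.le]
    change a e * (ρ e * p) = _
    rw [← mul_assoc, hρ, mul_div_cancel₀ _ (ha0 e).ne']

theorem memP1_of_mem_msSpace {L : ℝ} (hL : 0 < L) {A : ℝ → ℝ} {TH Th : Mesh L} {z : ℝ → ℝ}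
    (hz : z ∈ msSpace A TH Th) : MemP1 Th z := by
  induction hz using Submodule.span_induction with
  | mem ψ hψ => obtain ⟨i, -, -, h⟩ := hψ; exact h.1
  | zero => exact memP1_zero hL Th
  | add u v _ _ hu hv => exact hu.add hL hv
  | smul c u _ hu => exact hu.const_smul hL c

/-- The local problems are linear in `ψ`, and a function that vanishes at all coarse nodes is
admissible as a test function on every coarse element at once. -/
theorem integral_mul_weakDeriv_eq_zero_of_mem_msSpace {L : ℝ} (hL : 0 < L) {A : ℝ → ℝ}
    (hA : MemLp A ⊤ (vol L)) {TH Th : Mesh L} {z v : ℝ → ℝ} (hz : z ∈ msSpace A TH Th)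
    (hv : MemP1 Th v) (hv0 : ∀ j, v (TH.node j) = 0) :
    ∫ x in Ioo 0 L, A x * weakDeriv L z x * weakDeriv L v x = 0 := by
  have hv2 := hv.1.memLp_weakDeriv
  have hi : ∀ g : ℝ → ℝ, MemLp g 2 (vol L) →
      IntegrableOn (fun x => A x * g x * weakDeriv L v x) (Ioo 0 L) := fun g hg =>
    (memLp_two_mul_of_bounded hA hg).integrable_mul hv2
  induction hz using Submodule.span_induction with
  | mem ψ hψ =>
    obtain ⟨i, -, -, h⟩ := hψ
    rw [← TH.sum_integral (hi _ h.1.1.memLp_weakDeriv)]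
    exact Finset.sum_eq_zero fun k _ => h.2.2 k v hv (hv0 _) (hv0 _)
  | zero =>
    have h0 : weakDeriv L 0 =ᵐ[vol L] 0 :=
      IsAntideriv.weakDeriv_ae_eq hL ⟨integrableOn_zero, fun x _ => by simp⟩
    refine (integral_congr_ae (g := fun _ => (0 : ℝ)) ?_).trans (by simp)
    filter_upwards [h0] with x hx
    rw [hx]; simp
  | add u w hu hw ihu ihw =>
    have hu := (memP1_of_mem_msSpace hL hu).1
    have hw := (memP1_of_mem_msSpace hL hw).1
    have e : ∫ x in Ioo 0 L, A x * weakDeriv L (u + w) x * weakDeriv L v x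
        = ∫ x in Ioo 0 L, (A x * weakDeriv L u x * weakDeriv L v x
          + A x * weakDeriv L w x * weakDeriv L v x) := by
      refine integral_congr_ae ?_
      filter_upwards [hu.weakDeriv_add hL hw] with x hx
      rw [hx, Pi.add_apply]; ring
    rw [e, integral_add (hi _ hu.memLp_weakDeriv) (hi _ hw.memLp_weakDeriv), ihu, ihw, add_zero]
  | smul c u hu ihu =>
    have hu := (memP1_of_mem_msSpace hL hu).1
    have e : ∫ x in Ioo 0 L, A x * weakDeriv L (c • u) x * weakDeriv L v x
        = ∫ x in Ioo 0 L, c * (A x * weakDeriv L u x * weakDeriv L v x) := by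
      refine integral_congr_ae ?_
      filter_upwards [hu.weakDeriv_const_smul hL c] with x hx
      rw [hx, Pi.smul_apply, smul_eq_mul]; ring
    rw [e, integral_const_mul, ihu, mul_zero]

theorem exists_mem_msSpace_eq_at_nodes {L α₁ α₂ : ℝ} (hL : 0 < L) (hα : 0 < α₁) {A : ℝ → ℝ}
    (hA : MemLp A ⊤ (vol L)) (hA' : ∀ᵐ x ∂(vol L), α₁ ≤ A x ∧ A x ≤ α₂) {TH Th : Mesh L}
    (hR : Th.Refines TH) {u : ℝ → ℝ} (h0 : u 0 = 0) (h1 : u L = 0) :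
    ∃ z ∈ msSpace A TH Th, ∀ j, z (TH.node j) = u (TH.node j) := by
  classical
  have hex : ∀ i : Fin (TH.n + 1), ∃ ψ ∈ msSpace A TH Th,
      ∀ j, u (TH.node i) * ψ (TH.node j) = if j = i then u (TH.node i) else 0 := fun i => by
    by_cases hi : i ≠ 0 ∧ i ≠ Fin.last TH.n
    · obtain ⟨ψ, hψ⟩ := exists_isMsBasis hL hα hA hA' hR hi.1 hi.2
      exact ⟨ψ, Submodule.subset_span ⟨i, hi.1, hi.2, hψ⟩, fun j => by rw [hψ.2.1]; simp⟩
    · have hu : u (TH.node i) = 0 := by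
        rw [not_and_or, not_not, not_not] at hi
        rcases hi with rfl | rfl
        · rw [TH.node_zero, h0]
        · rw [TH.node_last, h1]
      -- Boundary nodes carry no basis function; as `u` vanishes there, zero takes its place.
      exact ⟨0, Submodule.zero_mem _, fun j => by simp [hu]⟩
  choose ψ hψ hψn using hex
  refine ⟨∑ i, u (TH.node i) • ψ i,
    Submodule.sum_mem _ fun i _ => Submodule.smul_mem _ _ (hψ i), fun j => ?_⟩
  simp only [Finset.sum_apply, Pi.smul_apply, smul_eq_mul, hψn]
  simp

/-! ### Stability and regularity of the solution -/

theorem aForm_eq {L b : ℝ} {A u v : ℝ → ℝ} (hL : 0 < L) (hA : MemLp A ⊤ (vol L))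
    (hu : MemH10 L u) (hv : MemH10 L v) :
    aForm L A b u v = (∫ x in Ioo 0 L, A x * weakDeriv L u x * weakDeriv L v x)
      + b * ∫ x in Ioo 0 L, weakDeriv L u x * v x := by
  have h1 : IntegrableOn (fun x => A x * weakDeriv L u x * weakDeriv L v x) (Ioo 0 L) :=
    (memLp_two_mul_of_bounded hA hu.memLp_weakDeriv).integrable_mul hv.memLp_weakDeriv
  have h2 : IntegrableOn (fun x => weakDeriv L u x * v x) (Ioo 0 L) :=
    hu.memLp_weakDeriv.integrable_mul ((hv.isAntideriv hL).memLp 2)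
  rw [aForm, ← integral_const_mul, ← integral_add h1 (h2.const_mul b)]
  refine integral_congr_ae (.of_forall fun x => ?_)
  simp only []
  ring

theorem abs_integral_mul_mul_le {L C : ℝ} {A g k : ℝ → ℝ} (hC : 0 ≤ C) (hA : MemLp A ⊤ (vol L))
    (hAC : ∀ᵐ x ∂(vol L), |A x| ≤ C) (hg : MemLp g 2 (vol L)) (hk : MemLp k 2 (vol L)) :
    |∫ x in Ioo 0 L, A x * g x * k x| ≤ C * normLp L 2 g * normLp L 2 k := by
  refine (abs_integral_mul_le_normLp (memLp_two_mul_of_bounded hA hg) hk).trans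
    (mul_le_mul_of_nonneg_right (normLp_le_mul_normLp hC hg ?_) (normLp_nonneg _ _ _))
  filter_upwards [hAC] with x hx
  rw [abs_mul]
  exact mul_le_mul_of_nonneg_right hx (abs_nonneg _)

theorem mul_normLp_sq_le {L α₁ α₂ : ℝ} {A g : ℝ → ℝ} (hA : MemLp A ⊤ (vol L))
    (hA' : ∀ᵐ x ∂(vol L), α₁ ≤ A x ∧ A x ≤ α₂) (hg : MemLp g 2 (vol L)) :
    α₁ * normLp L 2 g ^ 2 ≤ ∫ x in Ioo 0 L, A x * g x * g x := by
  rw [normLp_two_sq hg, ← integral_const_mul]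
  refine integral_mono_ae (hg.integrable_sq.const_mul _)
    ((memLp_two_mul_of_bounded hA hg).integrable_mul hg) ?_
  filter_upwards [hA'] with x hx
  have := mul_le_mul_of_nonneg_right hx.1 (sq_nonneg (g x))
  linarith

/-- The weight `m = c - s x` has slope minus the sign of `b`. For `u` vanishing at the end points,
`b ∫ u' m u = -(b / 2) ∫ m' u² = (|b| / 2) ∫ u²`: transport alone controls the `L²` norm. -/
theorem exists_weight {L b : ℝ} :
    ∃ s c : ℝ, s * b = |b| ∧ |s| = 1 ∧ ∀ x ∈ Ioo 0 L, 0 ≤ c - s * x ∧ c - s * x ≤ L := by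
  rcases le_or_gt 0 b with h | h
  · exact ⟨1, L, by rw [one_mul, abs_of_nonneg h], by simp,
      fun x hx => ⟨by linarith [hx.2], by linarith [hx.1]⟩⟩
  · exact ⟨-1, 0, by rw [abs_of_neg h]; ring, by simp,
      fun x hx => ⟨by linarith [hx.1], by linarith [hx.2]⟩⟩

/-- Eliminating `Z` leaves `U² ≤ y² + 2 y U` with `y = √(2 α₂ L / β) F / α₁`, whence `U ≤ (1 + √2) y
≤ 3 y`. -/
theorem le_three_mul_sqrt_mul {L α₁ α₂ β F U Z : ℝ} (hα : 0 < α₁) (hα' : α₁ ≤ α₂)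
    (hβ : 0 < β) (hP : α₂ ≤ β * L) (hF : 0 ≤ F) (hU : 0 ≤ U) (hZ : 0 ≤ Z)
    (h1 : α₁ * U ^ 2 ≤ F * Z) (h2 : β / 2 * Z ^ 2 ≤ (L * F + α₂ * U) * Z) :
    U ≤ 3 * (√(2 * α₂ * L / β) * (F / α₁)) := by
  have hα2 : 0 < α₂ := hα.trans_le hα'
  have hL : 0 < L := pos_of_mul_pos_right (hα2.trans_le hP) hβ.le
  set s := √(2 * α₂ * L / β) with hs
  have hs0 : 0 ≤ s := Real.sqrt_nonneg _
  have hs2 : s ^ 2 * β = 2 * α₂ * L := by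
    rw [hs, Real.sq_sqrt (by positivity)]; field_simp
  set y := s * (F / α₁) with hy
  have hy0 : 0 ≤ y := by positivity
  have hya : y * α₁ = s * F := by rw [hy]; field_simp
  have h3 : β * Z ≤ 2 * (L * F + α₂ * U) := by
    rcases hZ.eq_or_lt with hz | hz
    · rw [← hz, mul_zero]; positivity
    · have : β / 2 * Z ≤ L * F + α₂ * U := by
        refine le_of_mul_le_mul_right ?_ hz
        linarith
      linarith
  -- The global Péclet condition enters here: `(s β)² = 2 α₂ (β L) ≥ 2 α₂²`.
  have h4 : α₂ ≤ s * β := by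
    refine le_of_sq_le_sq ?_ (by positivity)
    have : (s * β) ^ 2 = 2 * α₂ * (β * L) := by
      rw [mul_pow, pow_two β, ← mul_assoc, hs2]; ring
    rw [this]
    nlinarith [mul_le_mul_of_nonneg_left hP hα2.le, mul_pos hα2 (mul_pos hβ hL)]
  have h5 : U ^ 2 ≤ y ^ 2 + 2 * y * U := by
    refine le_of_mul_le_mul_left ?_ (by positivity : (0 : ℝ) < β * α₁ ^ 2)
    have e1 : β * α₁ ^ 2 * (y ^ 2 + 2 * y * U)
        = s ^ 2 * β * F ^ 2 + 2 * (s * β) * (α₁ * F * U) := by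
      have : β * α₁ ^ 2 * (y ^ 2 + 2 * y * U)
          = β * (y * α₁) ^ 2 + 2 * β * α₁ * (y * α₁) * U := by ring
      rw [this, hya]; ring
    have e2 : β * α₁ ^ 2 * U ^ 2 ≤ α₁ * F * (2 * (L * F + α₂ * U)) := by
      calc β * α₁ ^ 2 * U ^ 2 = β * α₁ * (α₁ * U ^ 2) := by ring
        _ ≤ β * α₁ * (F * Z) := mul_le_mul_of_nonneg_left h1 (by positivity)
        _ = α₁ * F * (β * Z) := by ring
        _ ≤ _ := mul_le_mul_of_nonneg_left h3 (by positivity)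
    rw [e1, hs2]
    have e3 : α₂ * (α₁ * F * U) ≤ s * β * (α₁ * F * U) :=
      mul_le_mul_of_nonneg_right h4 (by positivity)
    have e4 : α₁ * (L * F ^ 2) ≤ α₂ * (L * F ^ 2) :=
      mul_le_mul_of_nonneg_right hα' (by positivity)
    linarith
  by_contra! hlt
  have hU0 : 0 < U := lt_of_le_of_lt (by positivity) hlt
  nlinarith [mul_pos hU0 (sub_pos.2 hlt), mul_nonneg hy0 (sub_pos.2 hlt).le, sq_nonneg y]

theorem IsSolution.normLp_weakDeriv_le {L α₁ α₂ b : ℝ} {A f u : ℝ → ℝ} (hL : 0 < L)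
    (hα : 0 < α₁) (hα' : α₁ ≤ α₂) (hb : b ≠ 0) (hA : MemLp A ⊤ (vol L))
    (hA' : ∀ᵐ x ∂(vol L), α₁ ≤ A x ∧ A x ≤ α₂) (hf : MemLp f 2 (vol L))
    (hP : α₂ ≤ |b| * L) (hu : IsSolution L A b f u) :
    normLp L 2 (weakDeriv L u) ≤ 3 * (√(2 * α₂ * L / |b|) * (normLp L 2 f / α₁)) := by
  have ha := hu.1.isAntideriv hL
  have hU := hu.1.memLp_weakDeriv
  have hZ := ha.memLp 2
  have hα2 : 0 ≤ α₂ := (hα.trans_le hα').le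
  have hAC : ∀ᵐ x ∂(vol L), |A x| ≤ α₂ := hA'.mono fun x hx =>
    abs_le.2 ⟨by linarith [hx.1], hx.2⟩
  refine le_three_mul_sqrt_mul (Z := normLp L 2 u) hα hα' (abs_pos.2 hb) hP
    (normLp_nonneg _ _ _) (normLp_nonneg _ _ _) (normLp_nonneg _ _ _) ?_ ?_
  · have h1 := hu.2 u hu.1
    rw [aForm_eq hL hA hu.1 hu.1, hu.1.integral_weakDeriv_mul_self hL, mul_zero, add_zero] at h1
    refine (mul_normLp_sq_le hA hA' hU).trans ?_
    rw [h1]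
    exact (le_abs_self _).trans (abs_integral_mul_le_normLp hf hZ)
  · obtain ⟨s, c, hsb, hs1, hm⟩ := exists_weight (L := L) (b := b)
    have hma : IsAntideriv L (fun x => c - s * x) (fun _ => -s) := by
      have h := IsAntideriv.of_contDiff hL.le (u := fun x : ℝ => c - s * x) (by fun_prop)
      have hd : deriv (fun x : ℝ => c - s * x) = fun _ => -s := by
        funext x
        have : HasDerivAt (fun x : ℝ => c - s * x) (-s) x := by
          simpa using ((hasDerivAt_id x).const_mul s).const_sub c
        exact this.deriv
      rwa [hd] at h
    have hv := hma.mul hL.le ha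
    set v : ℝ → ℝ := fun x => (c - s * x) * u x with hvdef
    have hmU : MemLp (fun x => (c - s * x) * weakDeriv L u x) 2 (vol L) :=
      memLp_two_mul_of_bounded (hma.memLp ⊤) hU
    have hsZ : MemLp (fun x => -s * u x) 2 (vol L) := hZ.const_mul (-s)
    have hv10 : MemH10 L v := hv.memH10 hL (hsZ.add hmU) (by simp [hvdef, hu.1.2.2.1])
      (by simp [hvdef, hu.1.2.2.2])
    have hv2 : MemLp v 2 (vol L) := hv.memLp 2
    have h1 := hu.2 v hv10
    rw [aForm_eq hL hA hu.1 hv10] at h1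
    have hAUm : MemLp (fun x => A x * weakDeriv L u x) 2 (vol L) := memLp_two_mul_of_bounded hA hU
    have e1 : ∫ x in Ioo 0 L, A x * weakDeriv L u x * weakDeriv L v x
        = -s * (∫ x in Ioo 0 L, A x * weakDeriv L u x * u x)
          + ∫ x in Ioo 0 L, A x * weakDeriv L u x * ((c - s * x) * weakDeriv L u x) := by
      have i1 : IntegrableOn (fun x => A x * weakDeriv L u x * u x) (Ioo 0 L) :=
        hAUm.integrable_mul hZ
      have i2 : IntegrableOn (fun x => A x * weakDeriv L u x * ((c - s * x) * weakDeriv L u x))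
        (Ioo 0 L) := hAUm.integrable_mul hmU
      rw [← integral_const_mul, ← integral_add (i1.const_mul _) i2]
      refine integral_congr_ae ?_
      filter_upwards [hv.weakDeriv_ae_eq hL] with x hx
      rw [hx]; ring
    have e2 : 2 * (∫ x in Ioo 0 L, weakDeriv L u x * v x) = s * normLp L 2 u ^ 2 := by
      have h2 := hv.integral_mul_add_mul hL.le ha
      rw [hu.1.2.2.1, hu.1.2.2.2] at h2
      have i1 : IntegrableOn (fun x => weakDeriv L u x * v x) (Ioo 0 L) := hU.integrable_mul hv2
      have e3 : ∫ x in Ioo 0 L, ((-s * u x + (c - s * x) * weakDeriv L u x) * u x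
            + (c - s * x) * u x * weakDeriv L u x)
          = ∫ x in Ioo 0 L, (2 * (weakDeriv L u x * v x) - s * u x ^ 2) :=
        integral_congr_ae (.of_forall fun x => by simp only [hvdef]; ring)
      rw [e3, integral_sub (i1.const_mul 2) (hZ.integrable_sq.const_mul s), integral_const_mul,
        integral_const_mul, ← normLp_two_sq hZ] at h2
      linarith
    have h3 : 0 ≤ ∫ x in Ioo 0 L, A x * weakDeriv L u x * ((c - s * x) * weakDeriv L u x) := by
      refine integral_nonneg_of_ae ?_
      filter_upwards [hA', ae_restrict_mem measurableSet_Ioo] with x hx hxL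
      have := mul_nonneg (mul_nonneg (hα.le.trans hx.1) (hm x hxL).1)
        (sq_nonneg (weakDeriv L u x))
      simp only [Pi.zero_apply]
      linarith
    have h4 := abs_integral_mul_mul_le hα2 hA hAC hU hZ
    have h5 := abs_integral_mul_le_normLp hf hv2
    have h6 : normLp L 2 v ≤ L * normLp L 2 u := by
      refine normLp_le_mul_normLp hL.le hZ ?_
      filter_upwards [ae_restrict_mem measurableSet_Ioo] with x hxL
      rw [hvdef, abs_mul, abs_of_nonneg (hm x hxL).1]
      exact mul_le_mul_of_nonneg_right (hm x hxL).2 (abs_nonneg _)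
    have h7 : |s * ∫ x in Ioo 0 L, A x * weakDeriv L u x * u x|
        ≤ α₂ * normLp L 2 (weakDeriv L u) * normLp L 2 u := by
      rwa [abs_mul, hs1, one_mul]
    have h8 := mul_le_mul_of_nonneg_left h6 (normLp_nonneg L 2 f)
    have e4 : |b| / 2 * normLp L 2 u ^ 2 = b * ∫ x in Ioo 0 L, weakDeriv L u x * v x := by
      rw [← hsb]
      linear_combination (-b / 2) * e2
    rw [e1, loadForm] at h1
    have h9 := (abs_le.1 h7).2
    have h10 := (abs_le.1 h5).2
    rw [e4]
    linarith

theorem IsSolution.isWeakDeriv_flux {L b : ℝ} {A f u : ℝ → ℝ} (hL : 0 < L)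
    (hA : MemLp A ⊤ (vol L)) (hf : MemLp f 2 (vol L)) (hu : IsSolution L A b f u) :
    IsWeakDeriv L (fun x => A x * weakDeriv L u x) (fun x => b * weakDeriv L u x - f x) := by
  have hU := hu.1.memLp_weakDeriv
  have hAU : MemLp (fun x => A x * weakDeriv L u x) 2 (vol L) := memLp_two_mul_of_bounded hA hU
  have hg : MemLp (fun x => b * weakDeriv L u x - f x) 2 (vol L) := (hU.const_mul b).sub hf
  refine ⟨(memLp_two_integrableOn hAU).locallyIntegrableOn,
    (memLp_two_integrableOn hg).locallyIntegrableOn, fun φ h1 _ h3 => ?_⟩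
  have hz : ∀ x, x ∉ Ioo 0 L → φ x = 0 := fun x hx =>
    image_eq_zero_of_notMem_tsupport fun hx' => hx (h3 hx')
  have hφ : IsAntideriv L φ (deriv φ) := .of_contDiff hL.le (h1.of_le (by simp))
  have hφ' : MemLp (deriv φ) 2 (vol L) :=
    (IsAntideriv.of_contDiff hL.le ((contDiff_infty_iff_deriv.1 h1).2.of_le (by simp))).memLp 2
  have hφ10 : MemH10 L φ := hφ.memH10 hL hφ' (hz 0 (by simp)) (hz L (by simp))
  have h4 := hu.2 φ hφ10
  rw [aForm_eq hL hA hu.1 hφ10, loadForm] at h4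
  have e1 : ∫ x in Ioo 0 L, A x * weakDeriv L u x * deriv φ x
      = ∫ x in Ioo 0 L, A x * weakDeriv L u x * weakDeriv L φ x := by
    refine integral_congr_ae ?_
    filter_upwards [hφ.weakDeriv_ae_eq hL] with x hx
    rw [hx]
  have i1 : IntegrableOn (fun x => weakDeriv L u x * φ x) (Ioo 0 L) :=
    hU.integrable_mul (hφ.memLp 2)
  have i2 : IntegrableOn (fun x => f x * φ x) (Ioo 0 L) := hf.integrable_mul (hφ.memLp 2)
  have e2 : ∫ x in Ioo 0 L, (b * weakDeriv L u x - f x) * φ x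
      = b * (∫ x in Ioo 0 L, weakDeriv L u x * φ x) - ∫ x in Ioo 0 L, f x * φ x := by
    rw [← integral_const_mul, ← integral_sub (i1.const_mul b) i2]
    exact integral_congr_ae (.of_forall fun x => by ring)
  rw [e1, e2]
  linarith

/-- `H²` regularity: `u'` is the flux times the reciprocal of `A`, both with absolutely continuous
representatives, and the product rule gives `u'' = -(f + (A' - b) u') / A`. -/
theorem IsSolution.exists_isAntideriv_weakDeriv {L α₁ α₂ b : ℝ} {A f u : ℝ → ℝ} (hL : 0 < L)
    (hα : 0 < α₁) (hA : MemW1 L ⊤ A) (hA' : ∀ᵐ x ∂(vol L), α₁ ≤ A x ∧ A x ≤ α₂)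
    (hf : MemLp f 2 (vol L)) (hu : IsSolution L A b f u) :
    ∃ p r, weakDeriv L u =ᵐ[vol L] p ∧ IsAntideriv L p r ∧ MemLp r 2 (vol L) ∧
      normLp L 2 r ≤ α₁⁻¹ * (normLp L 2 f
        + normLp L ⊤ (fun x => weakDeriv L A x - b) * normLp L 2 (weakDeriv L u)) := by
  have hU := hu.1.memLp_weakDeriv
  have hgm : MemLp (fun x => b * weakDeriv L u x - f x) 2 (vol L) := (hU.const_mul b).sub hf
  obtain ⟨q, hq, hAq⟩ := (hu.isWeakDeriv_flux hL hA.1 hf).exists_isAntideriv hL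
    (memLp_two_integrableOn hgm)
  obtain ⟨A₁, hA₁, hA₁m⟩ := hA.2
  have hA'm : MemLp (weakDeriv L A) ⊤ (vol L) := hA₁m.ae_eq hA₁.weakDeriv_ae_eq.symm
  obtain ⟨B, hB, hAB⟩ := hA₁.isWeakDeriv_weakDeriv.exists_isAntideriv hL (hA'm.integrable le_top)
  -- The lower bound, known almost everywhere, passes to every point for the continuous
  -- representative `B`.
  have hBα : ∀ x ∈ Icc 0 L, α₁ ≤ B x := by
    have h1 : EqOn B (fun x => max (B x) α₁) (Icc 0 L) := by
      refine Measure.eqOn_Icc_of_ae_eq volume hL.ne ?_ hB.continuousOn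
        (hB.continuousOn.sup continuousOn_const)
      rw [Measure.restrict_congr_set (Ioo_ae_eq_Icc (μ := volume)).symm]
      filter_upwards [hAB, hA'] with x hx hx'
      rw [← hx, max_eq_left hx'.1]
    exact fun x hx => (le_max_right _ _).trans_eq (h1 hx).symm
  have hBi := hB.inv hL.le hα hBα
  have hbA : MemLp (fun x => weakDeriv L A x - b) ⊤ (vol L) := hA'm.sub (memLp_const b)
  have hr1 : MemLp (fun x => (weakDeriv L A x - b) * weakDeriv L u x) 2 (vol L) :=
    memLp_two_mul_of_bounded hbA hU
  have hr2 : MemLp (f + fun x => (weakDeriv L A x - b) * weakDeriv L u x) 2 (vol L) := hf.add hr1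
  refine ⟨_, fun x => -((B x)⁻¹ * (f + fun x => (weakDeriv L A x - b) * weakDeriv L u x) x), ?_,
    (hq.mul hL.le hBi).congr_right ?_,
    (memLp_two_mul_of_bounded (hBi.memLp ⊤) hr2).neg, ?_⟩
  · filter_upwards [hAq, hAB, ae_restrict_mem measurableSet_Ioo] with x h1 h2 h3
    have h4 := (hα.trans_le (hBα x (Ioo_subset_Icc_self h3))).ne'
    rw [← h1, h2, mul_comm (B x), mul_assoc, mul_inv_cancel₀ h4, mul_one]
  · filter_upwards [hAq, hAB, ae_restrict_mem measurableSet_Ioo] with x h1 h2 h3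
    have h4 := (hα.trans_le (hBα x (Ioo_subset_Icc_self h3))).ne'
    rw [← h1, h2, Pi.add_apply]
    field_simp
    ring
  · refine (normLp_le_mul_normLp (inv_pos.2 hα).le hr2 ?_).trans
      (mul_le_mul_of_nonneg_left ((normLp_add_le hf hr1).trans (add_le_add le_rfl ?_))
        (inv_pos.2 hα).le)
    · filter_upwards [ae_restrict_mem measurableSet_Ioo] with x h3
      have h5 := hBα x (Ioo_subset_Icc_self h3)
      rw [abs_neg, abs_mul, abs_of_pos (inv_pos.2 (hα.trans_le h5))]
      exact mul_le_mul_of_nonneg_right (inv_anti₀ hα h5) (abs_nonneg _)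
    · refine normLp_le_mul_normLp (normLp_nonneg _ _ _) hU ?_
      filter_upwards [ae_abs_le_normLp_top hbA] with x hx
      rw [abs_mul]
      exact mul_le_mul_of_nonneg_right hx (abs_nonneg _)

/-! ### Error estimates -/

theorem IsSolution.integral_flux_eq {L b : ℝ} {A f u v : ℝ → ℝ} (hL : 0 < L)
    (hA : MemLp A ⊤ (vol L)) (hf : MemLp f 2 (vol L)) (hu : IsSolution L A b f u)
    (hv : MemH10 L v) :
    ∫ x in Ioo 0 L, A x * weakDeriv L u x * weakDeriv L v x
      = ∫ x in Ioo 0 L, (f x - b * weakDeriv L u x) * v x := by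
  have hvm := (hv.isAntideriv hL).memLp 2
  have i1 : IntegrableOn (fun x => weakDeriv L u x * v x) (Ioo 0 L) :=
    hu.1.memLp_weakDeriv.integrable_mul hvm
  have i2 : IntegrableOn (fun x => f x * v x) (Ioo 0 L) := hf.integrable_mul hvm
  have e : ∫ x in Ioo 0 L, (f x - b * weakDeriv L u x) * v x
      = (∫ x in Ioo 0 L, f x * v x) - b * ∫ x in Ioo 0 L, weakDeriv L u x * v x := by
    rw [← integral_const_mul, ← integral_sub i2 (i1.const_mul b)]
    exact integral_congr_ae (.of_forall fun x => by ring)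
  have h := hu.2 v hv
  rw [aForm_eq hL hA hu.1 hv, loadForm] at h
  rw [e]
  linarith

theorem le_sqrt_mul_add {α₁ α₂ X δ M : ℝ} (hα : 0 < α₁) (hα' : α₁ ≤ α₂) (hδ : 0 ≤ δ)
    (hM : 0 ≤ M) (h : α₁ * X ^ 2 ≤ α₂ * δ ^ 2 + 2 * M * (X + δ)) :
    X ≤ √(α₂ / α₁) * δ + 2 * (M / α₁) := by
  set R := √(α₂ / α₁) with hR
  have hR2 : R ^ 2 = α₂ / α₁ := Real.sq_sqrt (div_nonneg (hα.le.trans hα') hα.le)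
  have hR1 : 1 ≤ R := Real.one_le_sqrt.2 ((one_le_div hα).2 hα')
  set B := M / α₁ with hB
  have hB0 : 0 ≤ B := div_nonneg hM hα.le
  have h1 : X ^ 2 ≤ R ^ 2 * δ ^ 2 + 2 * B * (X + δ) := by
    refine le_of_mul_le_mul_left (h.trans_eq ?_) hα
    rw [hR2, hB]
    field_simp
  -- Completing the square; `1 ≤ R` turns `2 B δ` into the cross term `2 B R δ`.
  have h2 : (X - B) ^ 2 ≤ (R * δ + B) ^ 2 := by
    nlinarith [mul_nonneg (mul_nonneg (sub_nonneg.2 hR1) hδ) hB0]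
  have h3 := abs_le_of_sq_le_sq h2 (by positivity)
  linarith [(abs_le.1 h3).2]

/-- The error of the multiscale interpolant `z` of `u`, in terms of the error of the fine-scale
`P¹` interpolant `v`. -/
theorem IsSolution.normLp_sub_msInterpolant_le {L α₁ α₂ b : ℝ} {A f u v z : ℝ → ℝ}
    {TH Th : Mesh L} (hL : 0 < L) (hα : 0 < α₁) (hα' : α₁ ≤ α₂) (hA : MemLp A ⊤ (vol L))
    (hA' : ∀ᵐ x ∂(vol L), α₁ ≤ A x ∧ A x ≤ α₂) (hf : MemLp f 2 (vol L))
    (hu : IsSolution L A b f u) (hv : MemP1 Th v)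
    (hvu : ∀ j, v (TH.node j) = u (TH.node j)) (hz : z ∈ msSpace A TH Th)
    (hzu : ∀ j, z (TH.node j) = u (TH.node j)) :
    normLp L 2 (weakDeriv L u - weakDeriv L z)
      ≤ √(α₂ / α₁) * normLp L 2 (weakDeriv L u - weakDeriv L v)
        + 2 * (TH.size * normLp L 2 (fun x => f x - b * weakDeriv L u x) / α₁) := by
  have hzP := memP1_of_mem_msSpace hL hz
  have hyP := hv.sub hL hzP
  have hU := hu.1.memLp_weakDeriv
  have hV := hv.1.memLp_weakDeriv
  have hZ := hzP.1.memLp_weakDeriv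
  have hY := hyP.1.memLp_weakDeriv
  have hg : MemLp (fun x => f x - b * weakDeriv L u x) 2 (vol L) := hf.sub (hU.const_mul b)
  have hy0 : ∀ j, (v - z) (TH.node j) = 0 := fun j => by
    rw [Pi.sub_apply, hvu, hzu, sub_self]
  set D := weakDeriv L u - weakDeriv L z with hD
  set d := weakDeriv L u - weakDeriv L v with hd
  set G := normLp L 2 (fun x => f x - b * weakDeriv L u x) with hG
  have hD2 : MemLp D 2 (vol L) := hU.sub hZ
  have hd2 : MemLp d 2 (vol L) := hU.sub hV
  have hyD : weakDeriv L (v - z) =ᵐ[vol L] D - d := by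
    filter_upwards [hv.1.weakDeriv_sub hL hzP.1] with x hx
    simp only [hx, hD, hd, Pi.sub_apply]
    ring
  have h1 : ∫ x in Ioo 0 L, A x * D x * weakDeriv L (v - z) x
      ≤ G * (TH.size * (normLp L 2 D + normLp L 2 d)) := by
    have i1 : IntegrableOn (fun x => A x * weakDeriv L u x * weakDeriv L (v - z) x) (Ioo 0 L) :=
      (memLp_two_mul_of_bounded hA hU).integrable_mul hY
    have i2 : IntegrableOn (fun x => A x * weakDeriv L z x * weakDeriv L (v - z) x) (Ioo 0 L) :=
      (memLp_two_mul_of_bounded hA hZ).integrable_mul hY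
    have e1 : ∫ x in Ioo 0 L, A x * D x * weakDeriv L (v - z) x
        = ∫ x in Ioo 0 L, (f x - b * weakDeriv L u x) * (v - z) x := by
      have e2 := integral_sub i1 i2
      rw [integral_mul_weakDeriv_eq_zero_of_mem_msSpace hL hA hz hyP hy0, sub_zero,
        hu.integral_flux_eq hL hA hf hyP.1] at e2
      rw [← e2]
      refine integral_congr_ae (.of_forall fun x => ?_)
      simp only [hD, Pi.sub_apply]
      ring
    rw [e1]
    refine (le_abs_self _).trans ((abs_integral_mul_le_normLp hg
      ((hyP.1.isAntideriv hL).memLp 2)).trans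
      (mul_le_mul_of_nonneg_left ?_ (normLp_nonneg _ _ _)))
    refine (hyP.1.normLp_le_size_mul hL TH hy0).trans
      (mul_le_mul_of_nonneg_left ?_ TH.size_nonneg)
    rw [normLp_congr hyD]
    exact normLp_sub_le hD2 hd2
  have iDD : IntegrableOn (fun x => A x * D x * D x) (Ioo 0 L) :=
    (memLp_two_mul_of_bounded hA hD2).integrable_mul hD2
  have iDY : IntegrableOn (fun x => A x * D x * weakDeriv L (v - z) x) (Ioo 0 L) :=
    (memLp_two_mul_of_bounded hA hD2).integrable_mul hY
  -- From `D² = d² + 2 D (D - d) - (D - d)²`. Comparing energies rather than norms is what gives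
  -- `√(α₂ / α₁)` in place of `α₂ / α₁`.
  have h2 : ∫ x in Ioo 0 L, A x * D x * D x ≤ α₂ * normLp L 2 d ^ 2
      + 2 * ∫ x in Ioo 0 L, A x * D x * weakDeriv L (v - z) x := by
    rw [normLp_two_sq hd2, ← integral_const_mul, ← integral_const_mul,
      ← integral_add (hd2.integrable_sq.const_mul _) (iDY.const_mul _)]
    refine integral_mono_ae iDD ((hd2.integrable_sq.const_mul _).add (iDY.const_mul _)) ?_
    filter_upwards [hA', hyD] with x hx hxy
    rw [hxy, Pi.sub_apply]
    have e1 := mul_le_mul_of_nonneg_right hx.2 (sq_nonneg (d x))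
    have e2 := mul_nonneg (hα.le.trans hx.1) (sq_nonneg (D x - d x))
    linarith
  have h3 := mul_normLp_sq_le hA hA' hD2
  refine le_sqrt_mul_add hα hα' (normLp_nonneg _ _ _)
    (mul_nonneg TH.size_nonneg (normLp_nonneg _ _ _)) ?_
  linarith

/-! ### Discrete error of the stabilized scheme -/

theorem aUpw_eq {L b t : ℝ} {TH : Mesh L} {u v : ℝ → ℝ} (hu : MemH10 L u) (hv : MemH10 L v) :
    aUpw TH (fun _ => t) b u v
      = t * b ^ 2 * ∫ x in Ioo 0 L, weakDeriv L u x * weakDeriv L v x := by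
  have hi : IntegrableOn (fun x => weakDeriv L u x * weakDeriv L v x) (Ioo 0 L) :=
    hu.memLp_weakDeriv.integrable_mul hv.memLp_weakDeriv
  rw [aUpw, ← TH.sum_integral hi, Finset.mul_sum]
  refine Finset.sum_congr rfl fun k _ => ?_
  rw [← integral_const_mul]
  exact integral_congr_ae (.of_forall fun x => by ring)

theorem fStab_eq {L b t : ℝ} {TH : Mesh L} {f v : ℝ → ℝ} (hf : MemLp f 2 (vol L))
    (hv : MemH10 L v) :
    fStab TH (fun _ => t) b f v = t * b * ∫ x in Ioo 0 L, f x * weakDeriv L v x := by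
  have hi : IntegrableOn (fun x => f x * weakDeriv L v x) (Ioo 0 L) :=
    hf.integrable_mul hv.memLp_weakDeriv
  rw [fStab, ← TH.sum_integral hi, Finset.mul_sum]
  refine Finset.sum_congr rfl fun k _ => ?_
  rw [← integral_const_mul]
  exact integral_congr_ae (.of_forall fun x => by ring)

/-- Here `X` is the added diffusion `τ b²`. On division by `α₁ + X`, the term `3 X D` is at most `3
D`, so the bound is uniform in `X`. -/
theorem le_of_mul_sq_le {α₁ α₂ X ε D M : ℝ} (hα : 0 < α₁) (hα2 : 0 ≤ α₂) (hX : 0 ≤ X)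
    (hε : 0 ≤ ε) (hD : 0 ≤ D) (hM : 0 ≤ M)
    (h : (α₁ + X) * ε ^ 2 ≤ (α₂ * D + 3 * X * D + M) * ε) :
    ε ≤ (α₂ / α₁ + 3) * D + M / α₁ := by
  have hR : 0 ≤ α₂ / α₁ := div_nonneg hα2 hα.le
  have hM' : 0 ≤ M / α₁ := div_nonneg hM hα.le
  rcases hε.eq_or_lt with h0 | h0
  · rw [← h0]; positivity
  · have h1 : (α₁ + X) * ε ≤ α₂ * D + 3 * X * D + M := by
      refine le_of_mul_le_mul_right ?_ h0
      linarith
    have h2 : α₂ * D + 3 * X * D + M ≤ (α₁ + X) * ((α₂ / α₁ + 3) * D + M / α₁) := by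
      have e1 : α₁ * (α₂ / α₁) = α₂ := mul_div_cancel₀ _ hα.ne'
      have e2 : α₁ * (M / α₁) = M := mul_div_cancel₀ _ hα.ne'
      have e3 : (α₁ + X) * ((α₂ / α₁ + 3) * D + M / α₁)
          = α₁ * (α₂ / α₁) * D + α₁ * (M / α₁) + 3 * α₁ * D + 3 * X * D
            + X * (α₂ / α₁ * D) + X * (M / α₁) := by ring
      rw [e3, e1, e2]
      have : 0 ≤ 3 * α₁ * D + X * (α₂ / α₁ * D) + X * (M / α₁) := by positivity
      linarith
    exact le_of_mul_le_mul_left (h1.trans h2) (by linarith)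

/-- The distance between the Stab-MsFEM approximation `w` and an element `z` of the multiscale
space that agrees with `u` at the coarse nodes. -/
theorem IsStabMsFEM.normLp_sub_le {L α₁ α₂ b : ℝ} {A f u w z : ℝ → ℝ} {TH Th : Mesh L}
    (hL : 0 < L) (hα : 0 < α₁) (hα' : α₁ ≤ α₂) (hb : b ≠ 0) (hA : MemLp A ⊤ (vol L))
    (hA' : ∀ᵐ x ∂(vol L), α₁ ≤ A x ∧ A x ≤ α₂) (hf : MemLp f 2 (vol L))
    (hu : IsSolution L A b f u)
    (hw : IsStabMsFEM A b f TH Th (fun _ => TH.size / (2 * |b|)) w)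
    (hz : z ∈ msSpace A TH Th) (hzu : ∀ j, z (TH.node j) = u (TH.node j)) :
    normLp L 2 (weakDeriv L w - weakDeriv L z)
      ≤ (α₂ / α₁ + 3) * normLp L 2 (weakDeriv L u - weakDeriv L z)
        + TH.size / 2 * normLp L 2 (fun x => f x - b * weakDeriv L u x) / α₁ := by
  have hz10 := (memP1_of_mem_msSpace hL hz).1
  have hw10 := (memP1_of_mem_msSpace hL hw.1).1
  have he : w - z ∈ msSpace A TH Th := Submodule.sub_mem _ hw.1 hz
  have he10 := hw10.sub hL hz10
  have hd10 := hu.1.sub hL hz10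
  have hα2 : 0 ≤ α₂ := hα.le.trans hα'
  have hAC : ∀ᵐ x ∂(vol L), |A x| ≤ α₂ := hA'.mono fun x hx =>
    abs_le.2 ⟨by linarith [hx.1], hx.2⟩
  have hU := hu.1.memLp_weakDeriv
  have hW := hw10.memLp_weakDeriv
  have hg : MemLp (fun x => f x - b * weakDeriv L u x) 2 (vol L) := hf.sub (hU.const_mul b)
  rw [← normLp_congr (hw10.weakDeriv_sub hL hz10), ← normLp_congr (hu.1.weakDeriv_sub hL hz10)]
  have hwae : ∀ᵐ x ∂(vol L),
      weakDeriv L w x = weakDeriv L u x - weakDeriv L (u - z) x + weakDeriv L (w - z) x := by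
    filter_upwards [hw10.weakDeriv_sub hL hz10, hu.1.weakDeriv_sub hL hz10] with x h1 h2
    rw [h1, h2, Pi.sub_apply, Pi.sub_apply]
    ring
  have hdP := hd10.normLp_le_size_mul hL TH fun j => by rw [Pi.sub_apply, hzu, sub_self]
  set e := w - z with hedef
  set d := u - z with hddef
  set E := weakDeriv L e with hE
  set D := weakDeriv L d with hD
  have hE2 : MemLp E 2 (vol L) := he10.memLp_weakDeriv
  have hD2 : MemLp D 2 (vol L) := hd10.memLp_weakDeriv
  have he2 := (he10.isAntideriv hL).memLp 2
  have hd2 := (hd10.isAntideriv hL).memLp 2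
  -- Writing `w' = u' - D + E` in each term of the discrete equation lets the exact equation cancel
  -- the Galerkin part of `u`.
  have split : ∀ k : ℝ → ℝ, MemLp k 2 (vol L) → ∫ x in Ioo 0 L, weakDeriv L w x * k x
      = (∫ x in Ioo 0 L, weakDeriv L u x * k x) - (∫ x in Ioo 0 L, D x * k x)
        + ∫ x in Ioo 0 L, E x * k x := fun k hk => by
    have i1 : IntegrableOn (fun x => weakDeriv L u x * k x) (Ioo 0 L) := hU.integrable_mul hk
    have i2 : IntegrableOn (fun x => D x * k x) (Ioo 0 L) := hD2.integrable_mul hk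
    have i3 : IntegrableOn (fun x => E x * k x) (Ioo 0 L) := hE2.integrable_mul hk
    have i4 : IntegrableOn (fun x => weakDeriv L u x * k x - D x * k x) (Ioo 0 L) := i1.sub i2
    rw [← integral_sub i1 i2, ← integral_add i4 i3]
    refine integral_congr_ae ?_
    filter_upwards [hwae] with x hx
    rw [hx]; ring
  have hAE : MemLp (fun x => A x * E x) 2 (vol L) := memLp_two_mul_of_bounded hA hE2
  have assoc : ∀ g : ℝ → ℝ, ∫ x in Ioo 0 L, A x * g x * E x
      = ∫ x in Ioo 0 L, g x * (A x * E x) := fun g =>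
    integral_congr_ae (.of_forall fun x => by ring)
  have hdisc := hw.2 e he
  have hex := hu.2 e he10
  rw [aUpw_eq hw10 he10, fStab_eq hf he10, aForm_eq hL hA hw10 he10, assoc, split _ hAE,
    split _ he2, split _ hE2, he10.integral_weakDeriv_mul_self hL] at hdisc
  rw [aForm_eq hL hA hu.1 he10, assoc] at hex
  -- Moving the derivative onto `e` leaves `d`, which vanishes at the coarse nodes and so gains a
  -- factor `H`.
  have hDe : ∫ x in Ioo 0 L, D x * e x = - ∫ x in Ioo 0 L, d x * E x := by
    have h := (hd10.isAntideriv hL).integral_mul_deriv hL.le (he10.isAntideriv hL)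
    rw [hd10.2.2.1, hd10.2.2.2] at h
    rw [h]; ring
  have hres : ∫ x in Ioo 0 L, (f x - b * weakDeriv L u x) * E x
      = (∫ x in Ioo 0 L, f x * E x) - b * ∫ x in Ioo 0 L, weakDeriv L u x * E x := by
    have i1 : IntegrableOn (fun x => weakDeriv L u x * E x) (Ioo 0 L) := hU.integrable_mul hE2
    have i2 : IntegrableOn (fun x => f x * E x) (Ioo 0 L) := hf.integrable_mul hE2
    rw [← integral_const_mul, ← integral_sub i2 (i1.const_mul b)]
    exact integral_congr_ae (.of_forall fun x => by ring)
  have b0 := mul_normLp_sq_le hA hA' hE2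
  have b1 := abs_integral_mul_mul_le hα2 hA hAC hD2 hE2
  have b2 := (abs_integral_mul_le_normLp hd2 hE2).trans
    (mul_le_mul_of_nonneg_right hdP (normLp_nonneg _ _ _))
  have b3 := abs_integral_mul_le_normLp hD2 hE2
  have b4 := abs_integral_mul_le_normLp hg hE2
  have b5 : ∫ x in Ioo 0 L, E x * E x = normLp L 2 E ^ 2 := by
    rw [normLp_two_sq hE2]
    exact integral_congr_ae (.of_forall fun x => by ring)
  rw [assoc] at b0 b1
  rw [hDe, b5] at hdisc
  rw [hres] at b4
  set τ := TH.size / (2 * |b|) with hτ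
  have hb0 : 0 < |b| := abs_pos.2 hb
  have hH := TH.size_nonneg
  have hτ0 : 0 ≤ τ := by positivity
  have hτb : τ * |b| = TH.size / 2 := by rw [hτ]; field_simp
  have hτb2 : τ * b ^ 2 = TH.size * |b| / 2 := by
    rw [← sq_abs, pow_two, ← mul_assoc, hτb]; ring
  set ε := normLp L 2 E with hε
  set N := normLp L 2 D with hN
  set G := normLp L 2 (fun x => f x - b * weakDeriv L u x) with hG
  refine le_of_mul_sq_le (X := τ * b ^ 2) hα hα2 (by positivity) (normLp_nonneg _ _ _)
    (normLp_nonneg _ _ _) (mul_nonneg (by linarith) (normLp_nonneg _ _ _)) ?_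
  have c1 := (abs_le.1 b1).2
  have c2 : b * (-∫ x in Ioo 0 L, d x * E x) ≤ |b| * (TH.size * N * ε) := by
    refine (le_abs_self _).trans ?_
    rw [abs_mul, abs_neg]
    exact mul_le_mul_of_nonneg_left b2 hb0.le
  have c3 : τ * b ^ 2 * ∫ x in Ioo 0 L, D x * E x ≤ τ * b ^ 2 * (N * ε) :=
    mul_le_mul_of_nonneg_left ((le_abs_self _).trans b3) (by positivity)
  have c4 : τ * b * ((∫ x in Ioo 0 L, f x * E x) - b * ∫ x in Ioo 0 L, weakDeriv L u x * E x)
      ≤ TH.size / 2 * (G * ε) := by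
    refine (le_abs_self _).trans ?_
    rw [abs_mul, abs_mul, abs_of_nonneg hτ0, hτb]
    exact mul_le_mul_of_nonneg_left b4 (by linarith)
  -- The choice of `τ` makes the transport term exactly twice the stabilization scale; with the
  -- stabilization term `c3` this gives the coefficient 3.
  have c5 : |b| * (TH.size * N * ε) = 2 * (τ * b ^ 2) * (N * ε) := by rw [hτb2]; ring
  linarith

/-- The a priori bound times `|b|`, since `|b| √(2 α₂ L / |b|) = √(2 α₂ L |b|)`. -/
theorem IsSolution.normLp_residual_le {L α₁ α₂ b : ℝ} {A f u : ℝ → ℝ} (hL : 0 < L)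
    (hα : 0 < α₁) (hα' : α₁ ≤ α₂) (hb : b ≠ 0) (hA : MemLp A ⊤ (vol L))
    (hA' : ∀ᵐ x ∂(vol L), α₁ ≤ A x ∧ A x ≤ α₂) (hf : MemLp f 2 (vol L))
    (hP : α₂ ≤ |b| * L) (hu : IsSolution L A b f u) :
    normLp L 2 (fun x => f x - b * weakDeriv L u x)
      ≤ 3 * ((1 + √(2 * α₂ * L * |b|) / α₁) * normLp L 2 f) := by
  have hU := hu.1.memLp_weakDeriv
  have h1 : normLp L 2 (fun x => f x - b * weakDeriv L u x)
      ≤ normLp L 2 f + normLp L 2 (fun x => b * weakDeriv L u x) :=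
    StabMsFEM.normLp_sub_le hf (hU.const_mul b)
  rw [normLp_const_mul] at h1
  have hb0 : 0 < |b| := abs_pos.2 hb
  have h2 := mul_le_mul_of_nonneg_left
    (hu.normLp_weakDeriv_le hL hα hα' hb hA hA' hf hP) hb0.le
  have hα2 : 0 < α₂ := hα.trans_le hα'
  have h3 : |b| * √(2 * α₂ * L / |b|) = √(2 * α₂ * L * |b|) := by
    rw [eq_comm, Real.sqrt_eq_iff_mul_self_eq (by positivity) (by positivity), mul_mul_mul_comm,
      Real.mul_self_sqrt (by positivity)]
    field_simp
  have h4 : |b| * (3 * (√(2 * α₂ * L / |b|) * (normLp L 2 f / α₁)))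
      = 3 * (√(2 * α₂ * L * |b|) / α₁ * normLp L 2 f) := by
    rw [← h3]; ring
  linarith [normLp_nonneg L 2 f]

/-- The interpolation error on the fine mesh. -/
theorem IsSolution.exists_fine_interpolant {L α₁ α₂ b : ℝ} {A f u : ℝ → ℝ} (hL : 0 < L)
    (hα : 0 < α₁) (hα' : α₁ ≤ α₂) (hb : b ≠ 0) (hA : MemW1 L ⊤ A)
    (hA' : ∀ᵐ x ∂(vol L), α₁ ≤ A x ∧ A x ≤ α₂) (hf : MemLp f 2 (vol L))
    (hP : α₂ ≤ |b| * L) (hu : IsSolution L A b f u) (Th : Mesh L) :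
    ∃ v, MemP1 Th v ∧ (∀ j, v (Th.node j) = u (Th.node j)) ∧
      normLp L 2 (weakDeriv L u - weakDeriv L v) ≤ 3 * (Th.size *
        ((1 + √(2 * α₂ * L / |b|) * (normLp L ⊤ (fun x => weakDeriv L A x - b) / α₁))
          * (normLp L 2 f / α₁))) := by
  obtain ⟨v, hv, hvu, hv'⟩ := hu.1.exists_interpolant hL Th
  obtain ⟨p, r, hp, hpr, hr, hr'⟩ := hu.exists_isAntideriv_weakDeriv hL hα hA hA' hf
  refine ⟨v, hv, hvu, ?_⟩
  have h1 := hu.1.normLp_sub_step_le hL Th hp hpr hr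
  have h2 := hu.normLp_weakDeriv_le hL hα hα' hb hA.1 hA' hf hP
  rw [normLp_congr (Filter.EventuallyEq.rfl.sub hv')]
  set F := normLp L 2 f with hF
  have hF0 : 0 ≤ F := normLp_nonneg _ _ _
  set N := normLp L ⊤ (fun x => weakDeriv L A x - b) with hN
  have hN0 : 0 ≤ N := normLp_nonneg _ _ _
  set s := √(2 * α₂ * L / |b|) with hs
  have h3 : normLp L 2 r ≤ 3 * ((1 + s * (N / α₁)) * (F / α₁)) := by
    refine hr'.trans ?_
    have h4 := mul_le_mul_of_nonneg_left
      (add_le_add (le_refl F) (mul_le_mul_of_nonneg_left h2 hN0)) (inv_pos.2 hα).le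
    refine h4.trans ?_
    have e : 3 * ((1 + s * (N / α₁)) * (F / α₁))
        = α₁⁻¹ * (F + N * (3 * (s * (F / α₁)))) + 2 * (F / α₁) := by
      rw [div_eq_inv_mul, div_eq_inv_mul]; ring
    rw [e]
    have : 0 ≤ F / α₁ := div_nonneg hF0 hα.le
    linarith
  refine h1.trans ((mul_le_mul_of_nonneg_left h3 Th.size_nonneg).trans_eq ?_)
  ring

/-! ### Assembly of the estimates -/

theorem combine_error_bounds {R Y Q H h T K Φ M δ G X ε : ℝ} (hR : 1 ≤ R) (hY : 2 ≤ Y)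
    (hQ : 0 ≤ Q) (hH : 0 ≤ H) (hh : 0 ≤ h) (hT : R ≤ T) (hK : 0 ≤ K) (hΦ : 0 ≤ Φ) (hM : 0 ≤ M)
    (hδ : δ ≤ 3 * (h * M)) (hG : G ≤ 3 * (K * Φ)) (hX : X ≤ √R * δ + 2 * (H * G))
    (hε : ε ≤ (R + 3) * X + H / 2 * G) :
    X + ε ≤ 26 * (1 + Y + Y * T) * (h * (√R + Q) * M) + 26 * H * (1 + T) * K * Φ := by
  have hs : 0 ≤ √R := Real.sqrt_nonneg _
  have h1 : X ≤ √R * (3 * (h * M)) + 2 * (H * (3 * (K * Φ))) := by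
    have e1 := mul_le_mul_of_nonneg_left hδ hs
    have e2 := mul_le_mul_of_nonneg_left hG hH
    linarith
  have h2 : X + ε ≤ (R + 4) * (√R * (3 * (h * M)) + 2 * (H * (3 * (K * Φ))))
      + H / 2 * (3 * (K * Φ)) := by
    have e1 := mul_le_mul_of_nonneg_left h1 (by linarith : 0 ≤ R + 4)
    have e2 := mul_le_mul_of_nonneg_left hG (by linarith : 0 ≤ H / 2)
    linarith
  have hT0 : 0 ≤ T := by linarith
  -- The coarse Péclet condition, in the form `2 ≤ Y`, allows the contrast `R ≤ T` to be absorbed in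
  -- `Y * T`.
  have h3 : 3 * (R + 4) * (h * √R * M) ≤ 26 * (1 + Y + Y * T) * (h * (√R + Q) * M) := by
    have hYT : R ≤ Y * T := hT.trans (le_mul_of_one_le_left hT0 (by linarith))
    refine mul_le_mul (by linarith) ?_ (by positivity) (by positivity)
    exact mul_le_mul_of_nonneg_right
      (mul_le_mul_of_nonneg_left (by linarith) hh) hM
  -- The constant 26 comes from here: the left factor is `6 R + 25.5`.
  have h4 : (6 * (R + 4) + 3 / 2) * (H * (K * Φ)) ≤ 26 * (1 + T) * (H * (K * Φ)) :=
    mul_le_mul_of_nonneg_right (by linarith) (by positivity)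
  linarith

end StabMsFEM

theorem mainTheorem1 (L : ℝ) (hL : 0 < L) :
    ∃ C : ℝ, 0 < C ∧
      ∀ (α₁ α₂ b : ℝ) (A f u w : ℝ → ℝ) (TH Th : Mesh L),
        0 < α₁ → α₁ ≤ α₂ → b ≠ 0 →
        (∀ᵐ x ∂(vol L), α₁ ≤ A x ∧ A x ≤ α₂) →
        MemW1 L ⊤ A →
        MemLp f 2 (vol L) →
        Th.Refines TH →
        1 ≤ |b| * L / α₂ →
        1 ≤ |b| * TH.size / (2 * α₁) →
        IsSolution L A b f u →
        IsStabMsFEM A b f TH Th (fun _ => TH.size / (2 * |b|)) w →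
        seminormH1 L (u - w) ≤
          C * (1 + TH.size * |b| / α₁
              + TH.size * |b| / α₁ * √(α₂ ^ 2 / α₁ ^ 2 + |b| * TH.size / α₁))
            * fineError L α₁ α₂ b Th.size A f
          + C * TH.size * (1 + √(α₂ ^ 2 / α₁ ^ 2 + |b| * TH.size / α₁))
            * (1 + √(2 * α₂ * L * |b|) / α₁) * (normLp L 2 f / α₁) := by
  -- The constant is absolute: it does not even depend on `L`.
  refine ⟨26, by norm_num, ?_⟩
  intro α₁ α₂ b A f u w TH Th hα hα' hb hA' hA hf hR hP hPe hu hw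
  have hα2 : 0 < α₂ := hα.trans_le hα'
  have hP' : α₂ ≤ |b| * L := (one_le_div hα2).1 hP
  have hH := TH.size_nonneg
  have hh := Th.size_nonneg
  have hF := normLp_nonneg L 2 f
  have hN := normLp_nonneg L ⊤ (fun x => weakDeriv L A x - b)
  obtain ⟨z, hz, hzu⟩ := exists_mem_msSpace_eq_at_nodes hL hα hA.1 hA' hR hu.1.2.2.1 hu.1.2.2.2
  obtain ⟨v, hv, hvu, hδ⟩ := hu.exists_fine_interpolant hL hα hα' hb hA hA' hf hP' Th
  have hvu' : ∀ j, v (TH.node j) = u (TH.node j) := fun j => by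
    obtain ⟨m, hm⟩ := hR (mem_range_self j)
    rw [← hm, hvu]
  have hX := hu.normLp_sub_msInterpolant_le hL hα hα' hA.1 hA' hf hv hvu' hz hzu
  have hE := hw.normLp_sub_le hL hα hα' hb hA.1 hA' hf hu hz hzu
  have hG := hu.normLp_residual_le hL hα hα' hb hA.1 hA' hf hP'
  have hz10 := (memP1_of_mem_msSpace hL hz).1
  have hw10 := (memP1_of_mem_msSpace hL hw.1).1
  have hsum : seminormH1 L (u - w) ≤ normLp L 2 (weakDeriv L u - weakDeriv L z)
      + normLp L 2 (weakDeriv L w - weakDeriv L z) := by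
    have hU := hu.1.memLp_weakDeriv
    have hW := hw10.memLp_weakDeriv
    have hZ := hz10.memLp_weakDeriv
    rw [seminormH1, normLp_congr (hu.1.weakDeriv_sub hL hw10)]
    refine le_of_eq_of_le ?_ (normLp_sub_le (hU.sub hZ) (hW.sub hZ))
    rw [sub_sub_sub_cancel_right]
  refine hsum.trans ?_
  -- The square root in the statement enters only through this lower bound by the contrast.
  have hRT : α₂ / α₁ ≤ √(α₂ ^ 2 / α₁ ^ 2 + |b| * TH.size / α₁) := by
    refine Real.le_sqrt_of_sq_le ?_
    rw [div_pow]
    exact le_add_of_nonneg_right (by positivity)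
  have hY : 2 ≤ TH.size * |b| / α₁ := by
    rw [le_div_iff₀ (by positivity)] at hPe ⊢
    linarith
  have key := combine_error_bounds (R := α₂ / α₁) (Y := TH.size * |b| / α₁)
    (Q := |b| * Th.size / α₁) (H := TH.size) (h := Th.size)
    (K := 1 + √(2 * α₂ * L * |b|) / α₁) (Φ := normLp L 2 f / α₁)
    (M := (1 + √(2 * α₂ * L / |b|) * (normLp L ⊤ (fun x => weakDeriv L A x - b) / α₁))
      * (normLp L 2 f / α₁))
    (G := normLp L 2 (fun x => f x - b * weakDeriv L u x) / α₁)
    ((one_le_div hα).2 hα') hY (by positivity) hH hh hRT (by positivity) (by positivity)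
    (by positivity) hδ ?_ (hX.trans_eq (by ring)) (hE.trans_eq (by ring))
  · rw [fineError]
    refine key.trans_eq ?_
    ring
  · rw [div_le_iff₀ hα]
    refine hG.trans_eq ?_
    field_simp
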